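/- Let $n\ge 1$ and let $M,M'\subset\mathbb{C}^{n+1}$ be real-analytic hypersurfaces near the origin, both passing through $0$ and Levi-nondegenerate at $0$. **Associated system.** Choose linear coordinates $(z,w)=(z_1,\dots,z_n,w)$ of $\mathbb{C}^{n+1}$ in which $M$ is given near $0$ by a complex defining equation $w=\rho(z,\bar z,\bar w)$ with $\rho(z,\zeta,\omega)$ holomorphic near $0$. Put $p=\rho_z(0,0,0)\in\mathbb{C}^n$. The system associated with $M$ is the system $$w_{z_kz_l}=\Phi_{kl}(z,w,w'),\qquad w'=(w_{z_1},\dots,w_{z_n}),\quad k,l=1,\dots,n,$$ with $\Phi_{kl}$ holomorphic near $(0,0,p)$, that is satisfied by all graphs $w(z)=\rho(z,\zeta,\omega)$, $(\zeta,\omega)$ near $0$, of the Segre family, i.e. $\rho_{z_kz_l}=\Phi_{kl}(z,\rho,\rho_z)$ near $0$. **Transcendence degree.** Let $\mathcal K$ be the field of fractions of the ring of germs at $(0,0,p)$ of functions that are polynomial in $w'$ with coefficients holomorphic in $(z,w)$ near $0$, regarded as a subfield of the field of germs of meromorphic functions at $(0,0,p)$. Adjoin the functions $\Phi_{kl}$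 to $\mathcal K$ one after another (row by row), obtaining $\mathcal K=\mathcal L_0\subset\mathcal L_1\subset\dots\subset\mathcal L_{n^2}$. The jet transcendence degree of $M$ is the product $\prod_j[\mathcal L_j:\mathcal L_{j-1}]\in\{1,2,\dots\}\cup\{\infty\}$, that is, the transcendence degree of $\Phi=(\Phi_{kl})$ in $w'$ (for $n=1$: the minimal degree in $u$ of a nonzero polynomial in $w'$ and $u$, with coefficients holomorphic in $(z,w)$ near $0$, that vanishes identically after substituting $u=\Phi(z,w,w')$). **Proposition.** The jet transcendence degree of $M$ is well defined: such coordinates and such an associated system exist, and the degree does not depend on the choices made. It is invariant under local biholomorphisms: if there is a biholomorphic map $H$ between neighbourhoods of $0$ in $\mathbb{C}^{n+1}$ with $H(0)=0$ that maps $M$ onto $M'$ (within these neighbourhoods), then the jet transcendence degrees of $M$ and $M'$ at $0$ are equal. -/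

import Mathlib

open scoped Topology

noncomputable section

namespace JetTr

/-! ### Meromorphic germs -/

section Germs

variable {V : Type*} [NormedAddCommGroup V] [NormedSpace ℂ V]

/-- The ring of germs at `x₀` of holomorphic functions. -/
def holoGerms (x₀ : V) : Subring (Filter.Germ (𝓝 x₀) ℂ) where
  carrier := {g | ∃ f : V → ℂ, AnalyticAt ℂ f x₀ ∧ g = (f : Filter.Germ (𝓝 x₀) ℂ)}
  mul_mem' := by
    rintro _ _ ⟨f, hf, rfl⟩ ⟨g, hg, rfl⟩
    exact ⟨f * g, hf.mul hg, rfl⟩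
  one_mem' := ⟨1, analyticAt_const, rfl⟩
  add_mem' := by
    rintro _ _ ⟨f, hf, rfl⟩ ⟨g, hg, rfl⟩
    exact ⟨f + g, hf.add hg, rfl⟩
  zero_mem' := ⟨0, analyticAt_const, rfl⟩
  neg_mem' := by
    rintro _ ⟨f, hf, rfl⟩
    exact ⟨-f, hf.neg, rfl⟩

theorem eventually_zero_of_mul {x₀ : V} {f g : V → ℂ} (hf : AnalyticAt ℂ f x₀)
    (hg : AnalyticAt ℂ g x₀) (h : ∀ᶠ x in 𝓝 x₀, f x * g x = 0) :
    (∀ᶠ x in 𝓝 x₀, f x = 0) ∨ (∀ᶠ x in 𝓝 x₀, g x = 0) := by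
  obtain ⟨ε, hε, hb⟩ := Metric.eventually_nhds_iff_ball.1
    (hf.eventually_analyticAt.and (hg.eventually_analyticAt.and h))
  by_cases hz : ∀ x ∈ Metric.ball x₀ ε, f x = 0
  · exact Or.inl (Filter.eventually_of_mem (Metric.ball_mem_nhds x₀ hε) hz)
  · push Not at hz
    obtain ⟨y, hy, hfy⟩ := hz
    have hc : ∀ᶠ x in 𝓝 y, f x ≠ 0 := (hb y hy).1.continuousAt.eventually_ne hfy
    have hgy : g =ᶠ[𝓝 y] 0 := by
      filter_upwards [hc, Metric.isOpen_ball.mem_nhds hy] with x hx hxb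
      exact (mul_eq_zero.1 (hb x hxb).2.2).resolve_left hx
    have hpre : IsPreconnected (Metric.ball x₀ ε) := by
      let _ : NormedSpace ℝ V := NormedSpace.restrictScalars ℝ ℂ V
      exact (convex_ball x₀ ε).isPreconnected
    have hG : AnalyticOnNhd ℂ g (Metric.ball x₀ ε) := fun x hx => (hb x hx).2.1
    have := hG.eqOn_zero_of_preconnected_of_eventuallyEq_zero hpre hy hgy
    exact Or.inr (Filter.eventually_of_mem (Metric.ball_mem_nhds x₀ hε) this)

instance (x₀ : V) : IsDomain (holoGerms x₀) := by
  have : NoZeroDivisors (holoGerms x₀) := by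
    refine ⟨?_⟩
    rintro ⟨_, f, hf, rfl⟩ ⟨_, g, hg, rfl⟩ h
    have h' : ∀ᶠ x in 𝓝 x₀, f x * g x = 0 := Filter.Germ.coe_eq.1 (congrArg Subtype.val h)
    rcases eventually_zero_of_mul hf hg h' with h0 | h0
    · exact Or.inl (Subtype.ext (Filter.Germ.coe_eq.2 h0))
    · exact Or.inr (Subtype.ext (Filter.Germ.coe_eq.2 h0))
  exact NoZeroDivisors.to_isDomain _

/-- The field of germs at `x₀` of meromorphic functions. -/
abbrev MeroGerms (x₀ : V) : Type _ := FractionRing (holoGerms x₀)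

/-- The germ at `x₀` of a holomorphic function, as a meromorphic germ. -/
def toMero {x₀ : V} (f : V → ℂ) (hf : AnalyticAt ℂ f x₀) : MeroGerms x₀ :=
  algebraMap (holoGerms x₀) (MeroGerms x₀) ⟨(f : Filter.Germ (𝓝 x₀) ℂ), f, hf, rfl⟩

end Germs

/-! ### The transcendence degree of a vector function in a group of variables -/

section Degree

variable {X : Type*} [NormedAddCommGroup X] [NormedSpace ℂ X] {n : ℕ}

/-- `P (x, y)` is polynomial in `y`, with coefficients holomorphic in `x` near `x₀`. -/
def IsPseudoPoly (x₀ : X) (P : X × (Fin n → ℂ) → ℂ) : Prop :=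
  ∃ (s : Finset (Fin n → ℕ)) (a : (Fin n → ℕ) → X → ℂ),
    (∀ α ∈ s, AnalyticAt ℂ (a α) x₀) ∧
    ∀ x y, P (x, y) = ∑ α ∈ s, a α x * ∏ i, y i ^ α i

/-- The fraction field of the ring of germs at `(x₀, y₀)` of functions polynomial in `y`, inside
the field of meromorphic germs. -/
def baseField (x₀ : X) (y₀ : Fin n → ℂ) : Subfield (MeroGerms (x₀, y₀)) :=
  Subfield.closure {g | ∃ (P : X × (Fin n → ℂ) → ℂ) (hP : AnalyticAt ℂ P (x₀, y₀)),
    IsPseudoPoly x₀ P ∧ g = toMero P hP}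

/-- The transcendence degree in `y`, near `(x₀, y₀)`, of a vector function `F = (F₁, …, F_m)` of
`(x, y)`: the product of the degrees of the successive field extensions obtained by adjoining
`F₁, …, F_m` to the base field, with value `⊤` if one of these degrees is infinite. -/
def transcendenceDegree (x₀ : X) (y₀ : Fin n → ℂ) {m : ℕ} (F : Fin m → X × (Fin n → ℂ) → ℂ)
    (hF : ∀ j, AnalyticAt ℂ (F j) (x₀, y₀)) : ℕ∞ :=
  ∏ j : Fin m, Cardinal.toENat (IntermediateField.relrank
    (IntermediateField.adjoin (baseField x₀ y₀) ((fun i => toMero (F i) (hF i)) '' Set.Iio j))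
    (IntermediateField.adjoin (baseField x₀ y₀) ((fun i => toMero (F i) (hF i)) '' Set.Iic j)))

end Degree

/-! ### Levi-nondegenerate real-analytic hypersurfaces -/

/-- The space `ℂⁿ⁺¹` with coordinates `(z, w) = (z₁, …, zₙ, w)`. -/
abbrev CSpace (n : ℕ) : Type := (Fin n → ℂ) × ℂ

/-- `r` is a real-analytic local defining function, with nonzero differential at `0`, of the
hypersurface `M` passing through `0`. -/
def IsDefiningFunction {n : ℕ} (M : Set (CSpace n)) (r : CSpace n → ℝ) : Prop :=
  AnalyticAt ℝ r 0 ∧ r 0 = 0 ∧ fderiv ℝ r 0 ≠ 0 ∧ ∀ᶠ x in 𝓝 (0 : CSpace n), x ∈ M ↔ r x = 0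

/-- `v` lies in the complex tangent space at `0` of `{r = 0}`. -/
def IsComplexTangent {n : ℕ} (r : CSpace n → ℝ) (v : CSpace n) : Prop :=
  fderiv ℝ r 0 v = 0 ∧ fderiv ℝ r 0 (Complex.I • v) = 0

/-- The real second derivative of `r` at `0`. -/
def hess {n : ℕ} (r : CSpace n → ℝ) (u v : CSpace n) : ℝ := fderiv ℝ (fderiv ℝ r) 0 u v

/-- The complex Hessian `∑ (∂²r / ∂x_j ∂x̄_k)(0) u_j v̄_k`, written through real second
derivatives. -/
def leviForm {n : ℕ} (r : CSpace n → ℝ) (u v : CSpace n) : ℂ :=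
  (1 / 4 : ℂ) *
    (((hess r u v + hess r (Complex.I • u) (Complex.I • v) : ℝ) : ℂ) +
      Complex.I * ((hess r u (Complex.I • v) - hess r (Complex.I • u) v : ℝ) : ℂ))

/-- `M` is, near `0 ∈ M`, a real-analytic hypersurface, Levi-nondegenerate at `0`. -/
def IsLeviNondegenerateHypersurface {n : ℕ} (M : Set (CSpace n)) : Prop :=
  ∃ r : CSpace n → ℝ, IsDefiningFunction M r ∧
    ∀ u, IsComplexTangent r u → (∀ v, IsComplexTangent r v → leviForm r u v = 0) → u = 0

/-! ### The associated system of differential equations -/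

/-- `ρ (z, ζ, ω)` is a complex defining function of `M`: near `0`, the hypersurface `M` is
`w = ρ (z, z̄, w̄)` with `ρ` holomorphic. The Segre varieties of `M` are then the graphs
`w = ρ (z, ā, b̄)`. -/
def IsComplexDefiningFunction {n : ℕ} (M : Set (CSpace n))
    (ρ : (Fin n → ℂ) × (Fin n → ℂ) × ℂ → ℂ) : Prop :=
  AnalyticAt ℂ ρ 0 ∧ ∀ᶠ x in 𝓝 (0 : CSpace n), x ∈ M ↔ x.2 = ρ (x.1, star x.1, star x.2)

/-- The partial derivative in `z_j` of a function of `(z, ζ, ω)`. -/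
def dz {n : ℕ} (j : Fin n) (f : (Fin n → ℂ) × (Fin n → ℂ) × ℂ → ℂ) :
    (Fin n → ℂ) × (Fin n → ℂ) × ℂ → ℂ :=
  fun q => fderiv ℂ f q (Pi.single j 1, 0, 0)

/-- `w_{z_k z_l} = Φ_{kl} (z, w, w')`, with `Φ` holomorphic near `(0, 0, p)`, is the system of
differential equations associated with `M`: it is satisfied by all the graphing functions
`w (z) = ρ (z, ζ, ω)` of the Segre family of `M` near `0`. Here `p` is the value of
`w' = (w_{z_1}, …, w_{z_n})` at the origin for the Segre variety of the origin. -/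
def IsAssociatedSystem {n : ℕ} (M : Set (CSpace n)) (p : Fin n → ℂ)
    (Φ : Fin n → Fin n → CSpace n × (Fin n → ℂ) → ℂ) : Prop :=
  ∃ ρ, IsComplexDefiningFunction M ρ ∧ (∀ j, p j = dz j ρ 0) ∧
    (∀ k l, AnalyticAt ℂ (Φ k l) (0, p)) ∧
    ∀ᶠ q in 𝓝 (0 : (Fin n → ℂ) × (Fin n → ℂ) × ℂ), ∀ k l,
      dz k (dz l ρ) q = Φ k l ((q.1, ρ q), fun j => dz j ρ q)

/-- The jet transcendence degree of `M` is `d`: in some linear coordinates `(z, w)` of `ℂⁿ⁺¹` in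
which `M` has a complex defining function `w = ρ (z, z̄, w̄)`, the transcendence degree in `w'` of
the right-hand side `Φ = (Φ_{kl})` (its entries being listed row by row) of the associated system
equals `d`. -/
def IsJetTranscendenceDegree {n : ℕ} (M : Set (CSpace n)) (d : ℕ∞) : Prop :=
  ∃ (L : CSpace n ≃L[ℂ] CSpace n) (p : Fin n → ℂ)
    (Φ : Fin n → Fin n → CSpace n × (Fin n → ℂ) → ℂ)
    (hΦ : ∀ k l, AnalyticAt ℂ (Φ k l) (0, p)),
    IsAssociatedSystem (L '' M) p Φ ∧
    d = transcendenceDegree (0 : CSpace n) p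
      (fun j : Fin (n * n) => Φ (finProdFinEquiv.symm j).1 (finProdFinEquiv.symm j).2)
      (fun _ => hΦ _ _)

/-! ### Local biholomorphisms -/

/-- `H` is a biholomorphism between neighbourhoods of `0` which fixes `0` and maps `M` onto `M'`. -/
def IsLocalBiholomorphism {n : ℕ} (M M' : Set (CSpace n))
    (H : OpenPartialHomeomorph (CSpace n) (CSpace n)) : Prop :=
  0 ∈ H.source ∧ H 0 = 0 ∧ AnalyticOnNhd ℂ H H.source ∧ AnalyticOnNhd ℂ H.symm H.target ∧
    H '' (M ∩ H.source) = M' ∩ H.target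

end JetTr

end

/-! The degree can be computed on the complexification of `M`, with coordinates `(z, ζ, ω)`.
Levi-nondegeneracy makes the jet map `(z, ζ, ω) ↦ (z, ρ, ρ_z)` a local biholomorphism
(`exists_isBiholoGerm_segreJet`). Hence the associated system exists, with `Φ` equal to `ρ_zz`
composed with the inverse of the jet map. Pulling back along the jet map turns the base field into
the field generated by the functions of `(z, ρ)` and by `ρ_z`, and adjoining `Φ` becomes adjoining
`ρ_zz`. By multiplicativity of degrees the product in the definition is the degree of this single
extension (`transcendenceDegree_eq_relrank`).

A biholomorphism `G = (F, g)` from one hypersurface to another sends Segre varieties to Segre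
varieties: `ρ' (F (z, ρ), Ḡ (ζ, ω)) = g (z, ρ)` (`segreGraph_segreTransform`). Differentiating in
`z` gives linear systems for the pulled-back `ρ'_z` and `ρ'_zz`; their matrix `∂_z F (z, ρ)` is
invertible at `0` and has entries in the smaller field. So both fields of `ρ'` pull back into those
of `ρ`; the inverse map gives equality, and the degrees agree (`relrank_segreField_eq`).
Independence of choices is the case of the identity map, because the linear coordinate changes are
absorbed into `G`.

The passage from `M` to its complexification rests on `vanish_on_complexification`: a holomorphic
function vanishing on `M` vanishes on all of `{R = 0}`. `IsNondegComplexification` collects the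
facts about `R` used afterwards. -/

noncomputable section

namespace JetTr

/-! ### Germs of biholomorphic maps and pull-back of meromorphic germs. -/

section Pullback

variable {V W U : Type*} [NormedAddCommGroup V] [NormedSpace ℂ V]
  [NormedAddCommGroup W] [NormedSpace ℂ W] [NormedAddCommGroup U] [NormedSpace ℂ U]

/-- `φ` is a germ at `x` of a biholomorphic map, with inverse germ `ψ` at `y = φ x`. -/
structure IsBiholoGerm (x : V) (y : W) (φ : V → W) (ψ : W → V) : Prop where
  analytic : AnalyticAt ℂ φ x
  map_base : φ x = y
  analytic_symm : AnalyticAt ℂ ψ y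
  left_inv : ∀ᶠ a in 𝓝 x, ψ (φ a) = a
  right_inv : ∀ᶠ b in 𝓝 y, φ (ψ b) = b

theorem IsBiholoGerm.map_base_symm {x : V} {y : W} {φ : V → W} {ψ : W → V}
    (h : IsBiholoGerm x y φ ψ) : ψ y = x := by
  rw [← h.map_base]; exact h.left_inv.self_of_nhds

theorem IsBiholoGerm.symm {x : V} {y : W} {φ : V → W} {ψ : W → V}
    (h : IsBiholoGerm x y φ ψ) : IsBiholoGerm y x ψ φ :=
  ⟨h.analytic_symm, h.map_base_symm, h.analytic, h.right_inv, h.left_inv⟩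

theorem IsBiholoGerm.tendsto {x : V} {y : W} {φ : V → W} {ψ : W → V}
    (h : IsBiholoGerm x y φ ψ) : Filter.Tendsto φ (𝓝 x) (𝓝 y) := by
  have := h.analytic.continuousAt.tendsto
  rwa [h.map_base] at this

theorem IsBiholoGerm.trans {x : V} {y : W} {u : U} {φ : V → W} {ψ : W → V} {φ' : W → U}
    {ψ' : U → W} (h : IsBiholoGerm x y φ ψ) (h' : IsBiholoGerm y u φ' ψ') :
    IsBiholoGerm x u (φ' ∘ φ) (ψ ∘ ψ') where
  analytic := AnalyticAt.comp (by rw [h.map_base]; exact h'.analytic) h.analytic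
  map_base := by simp [h.map_base, h'.map_base]
  analytic_symm := AnalyticAt.comp (by rw [h'.map_base_symm]; exact h.analytic_symm)
    h'.analytic_symm
  left_inv := by
    filter_upwards [h.left_inv, h.tendsto.eventually h'.left_inv] with a h1 h2
    simp [h1, h2]
  right_inv := by
    filter_upwards [h'.right_inv, h'.symm.tendsto.eventually h.right_inv] with a h1 h2
    simp [h1, h2]

theorem IsBiholoGerm.comp_analyticAt {x : V} {y : W} {φ : V → W} {ψ : W → V}
    (h : IsBiholoGerm x y φ ψ) {E : Type*} [NormedAddCommGroup E] [NormedSpace ℂ E]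
    {f : W → E} (hf : AnalyticAt ℂ f y) :
    AnalyticAt ℂ (f ∘ φ) x :=
  AnalyticAt.comp (by rw [h.map_base]; exact hf) h.analytic

/-- Pull-back of holomorphic germs. -/
def IsBiholoGerm.pullHolo {x : V} {y : W} {φ : V → W} {ψ : W → V} (h : IsBiholoGerm x y φ ψ) :
    holoGerms y →+* holoGerms x where
  toFun g := ⟨g.1.compTendsto φ h.tendsto, by
    obtain ⟨_, f, hf, rfl⟩ := g
    exact ⟨f ∘ φ, h.comp_analyticAt hf, rfl⟩⟩
  map_one' := rfl
  map_zero' := rfl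
  map_mul' := by
    rintro ⟨_, f, hf, rfl⟩ ⟨_, g, hg, rfl⟩; rfl
  map_add' := by
    rintro ⟨_, f, hf, rfl⟩ ⟨_, g, hg, rfl⟩; rfl

/-- Composing with `ψ` recovers the germ. Injectivity is what lets the pull-back extend to fraction
fields. -/
theorem IsBiholoGerm.pullHolo_injective {x : V} {y : W} {φ : V → W} {ψ : W → V}
    (h : IsBiholoGerm x y φ ψ) : Function.Injective h.pullHolo := by
  rintro ⟨_, f, hf, rfl⟩ ⟨_, g, hg, rfl⟩ hfg
  have h' : ∀ᶠ a in 𝓝 x, f (φ a) = g (φ a) :=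
    Filter.Germ.coe_eq.1 (congrArg Subtype.val hfg)
  refine Subtype.ext (Filter.Germ.coe_eq.2 ?_)
  filter_upwards [h.right_inv, h.symm.tendsto.eventually h'] with b h1 h2
  simpa [h1] using h2

/-- Pull-back of meromorphic germs. -/
def IsBiholoGerm.pull {x : V} {y : W} {φ : V → W} {ψ : W → V} (h : IsBiholoGerm x y φ ψ) :
    MeroGerms y →+* MeroGerms x :=
  IsFractionRing.map h.pullHolo_injective

theorem IsBiholoGerm.pull_toMero {x : V} {y : W} {φ : V → W} {ψ : W → V}
    (h : IsBiholoGerm x y φ ψ) {f : W → ℂ} (hf : AnalyticAt ℂ f y) :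
    h.pull (toMero f hf) = toMero (f ∘ φ) (h.comp_analyticAt hf) := by
  unfold IsBiholoGerm.pull toMero IsFractionRing.map
  rw [IsLocalization.map_eq]
  rfl

theorem toMero_congr {x : V} {f g : V → ℂ} (hf : AnalyticAt ℂ f x) (hg : AnalyticAt ℂ g x)
    (h : f =ᶠ[𝓝 x] g) : toMero f hf = toMero g hg := by
  unfold toMero
  congr 1
  exact Subtype.ext (Filter.Germ.coe_eq.2 h)

theorem toMero_add {x : V} {f g : V → ℂ} (hf : AnalyticAt ℂ f x) (hg : AnalyticAt ℂ g x) :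
    toMero (fun a => f a + g a) (hf.add hg) = toMero f hf + toMero g hg :=
  map_add (algebraMap (holoGerms x) (MeroGerms x)) ⟨_, f, hf, rfl⟩ ⟨_, g, hg, rfl⟩

theorem toMero_mul {x : V} {f g : V → ℂ} (hf : AnalyticAt ℂ f x) (hg : AnalyticAt ℂ g x) :
    toMero (fun a => f a * g a) (hf.mul hg) = toMero f hf * toMero g hg :=
  map_mul (algebraMap (holoGerms x) (MeroGerms x)) ⟨_, f, hf, rfl⟩ ⟨_, g, hg, rfl⟩

theorem toMero_zero {x : V} : toMero (fun _ => 0) (analyticAt_const (x := x)) = 0 :=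
  map_zero (algebraMap (holoGerms x) (MeroGerms x))

theorem toMero_one {x : V} : toMero (fun _ => 1) (analyticAt_const (x := x)) = 1 :=
  map_one (algebraMap (holoGerms x) (MeroGerms x))

/-- A homomorphism out of a fraction field is determined on the ring, so only holomorphic germs need
checking. -/
theorem IsBiholoGerm.pull_pull {x : V} {y : W} {φ : V → W} {ψ : W → V}
    (h : IsBiholoGerm x y φ ψ) (m : MeroGerms x) : h.pull (h.symm.pull m) = m := by
  have : h.pull.comp h.symm.pull = RingHom.id _ := by
    apply IsLocalization.ringHom_ext (nonZeroDivisors (holoGerms x))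
    ext ⟨_, f, hf, rfl⟩
    change h.pull (h.symm.pull (toMero f hf)) = toMero f hf
    rw [h.symm.pull_toMero, h.pull_toMero]
    apply toMero_congr
    filter_upwards [h.left_inv] with a ha
    simp [ha]
  exact congrArg (fun g => g m) this

end Pullback

/-! ### Holomorphic germs in a subfield of meromorphic germs, and linear systems over it. -/

section SubfieldMembership

variable {V : Type*} [NormedAddCommGroup V] [NormedSpace ℂ V] {x : V}

/-- The germ of `f` at `x` is holomorphic and lies in the field `T` of meromorphic germs. -/
def GermIn (T : Subfield (MeroGerms x)) (f : V → ℂ) : Prop :=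
  ∃ hf : AnalyticAt ℂ f x, toMero f hf ∈ T

variable {T T' : Subfield (MeroGerms x)} {f g : V → ℂ}

theorem GermIn.mono (h : T ≤ T') (hf : GermIn T f) : GermIn T' f := ⟨hf.1, h hf.2⟩

theorem GermIn.congr (hf : GermIn T f) (h : f =ᶠ[𝓝 x] g) : GermIn T g :=
  ⟨hf.1.congr h, toMero_congr hf.1 (hf.1.congr h) h ▸ hf.2⟩

theorem GermIn.add (hf : GermIn T f) (hg : GermIn T g) : GermIn T (fun a => f a + g a) :=
  ⟨hf.1.add hg.1, by rw [toMero_add hf.1 hg.1]; exact T.add_mem hf.2 hg.2⟩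

theorem GermIn.sub (hf : GermIn T f) (hg : GermIn T g) : GermIn T (fun a => f a - g a) :=
  ⟨hf.1.sub hg.1, by
    have : toMero (fun a => f a - g a) (hf.1.sub hg.1) = toMero f hf.1 - toMero g hg.1 :=
      map_sub (algebraMap (holoGerms x) (MeroGerms x)) ⟨_, f, hf.1, rfl⟩ ⟨_, g, hg.1, rfl⟩
    rw [this]; exact T.sub_mem hf.2 hg.2⟩

theorem GermIn.mul (hf : GermIn T f) (hg : GermIn T g) : GermIn T (fun a => f a * g a) :=
  ⟨hf.1.mul hg.1, by rw [toMero_mul hf.1 hg.1]; exact T.mul_mem hf.2 hg.2⟩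

theorem GermIn.zero : GermIn T (fun _ => 0) :=
  ⟨analyticAt_const, by rw [toMero_zero]; exact T.zero_mem⟩

theorem GermIn.one : GermIn T (fun _ => 1) :=
  ⟨analyticAt_const, by rw [toMero_one]; exact T.one_mem⟩

theorem GermIn.sum {ι : Type*} (s : Finset ι) {F : ι → V → ℂ} (h : ∀ i ∈ s, GermIn T (F i)) :
    GermIn T (fun a => ∑ i ∈ s, F i a) := by
  classical
  induction s using Finset.induction_on with
  | empty => simpa using GermIn.zero
  | insert i s hi ih =>
    simp_rw [Finset.sum_insert hi]
    exact (h i (by simp)).add (ih fun j hj => h j (by simp [hj]))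

theorem GermIn.prod {ι : Type*} (s : Finset ι) {F : ι → V → ℂ} (h : ∀ i ∈ s, GermIn T (F i)) :
    GermIn T (fun a => ∏ i ∈ s, F i a) := by
  classical
  induction s using Finset.induction_on with
  | empty => simpa using GermIn.one
  | insert i s hi ih =>
    simp_rw [Finset.prod_insert hi]
    exact (h i (by simp)).mul (ih fun j hj => h j (by simp [hj]))

theorem GermIn.pow (hf : GermIn T f) (k : ℕ) : GermIn T (fun a => f a ^ k) := by
  simpa using GermIn.prod (Finset.range k) (F := fun _ => f) (fun _ _ => hf)

end SubfieldMembership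

/-- A linear system over a subfield with nonsingular matrix has its solution in the subfield. -/
theorem mem_subfield_of_linear_system {E : Type*} [Field E] (T : Subfield E) {n : ℕ}
    (A : Matrix (Fin n) (Fin n) E) (hA : ∀ i j, A i j ∈ T) (hdet : A.det ≠ 0) (b v : Fin n → E)
    (hb : ∀ i, b i ∈ T) (h : ∀ i, ∑ j, A i j * v j = b i) (j : Fin n) : v j ∈ T := by
  let A₀ : Matrix (Fin n) (Fin n) T := fun i j => ⟨A i j, hA i j⟩
  let b₀ : Fin n → T := fun i => ⟨b i, hb i⟩
  have hAm : A = T.subtype.mapMatrix A₀ := rfl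
  have hd : A₀.det ≠ 0 := by
    rw [hAm, ← RingHom.map_det] at hdet
    exact fun h0 => hdet (by rw [h0, map_zero])
  have hu : IsUnit A₀.det := isUnit_iff_ne_zero.2 hd
  -- The system is solved inside `T` by `A₀⁻¹ b₀`; injectivity of `A` over `E` identifies this
  -- solution with `v`.
  have hs : A₀.mulVec (A₀⁻¹.mulVec b₀) = b₀ := by
    rw [Matrix.mulVec_mulVec, Matrix.mul_nonsing_inv _ hu, Matrix.one_mulVec]
  have hv : A.mulVec v = A.mulVec (fun i => ((A₀⁻¹.mulVec b₀) i : E)) := by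
    ext i
    have h2 := congrArg (fun u => ((u i : T) : E)) hs
    simp only [Matrix.mulVec, dotProduct, AddSubmonoidClass.coe_finsetSum,
      MulMemClass.coe_mul] at h2
    simp only [Matrix.mulVec, dotProduct, AddSubmonoidClass.coe_finsetSum, MulMemClass.coe_mul]
    rw [h i]
    exact h2.symm
  have := Matrix.mulVec_injective_of_isUnit
    ((Matrix.isUnit_iff_isUnit_det A).2 (isUnit_iff_ne_zero.2 hdet)) hv
  rw [this]
  exact Subtype.mem _

/-- A linear system of holomorphic germs, nonsingular at the base point, with coefficients in
a field `T` of meromorphic germs has its solution in `T`. -/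
theorem germIn_of_linear_system {V : Type*} [NormedAddCommGroup V] [NormedSpace ℂ V] {x : V}
    {T : Subfield (MeroGerms x)} {n : ℕ} {A : Fin n → Fin n → V → ℂ} {b v : Fin n → V → ℂ}
    (hA : ∀ i j, GermIn T (A i j)) (hdet : Matrix.det (Matrix.of fun i j => A i j x) ≠ 0)
    (hb : ∀ i, GermIn T (b i)) (hv : ∀ i, AnalyticAt ℂ (v i) x)
    (h : ∀ i, ∀ᶠ a in 𝓝 x, ∑ j, A i j a * v j a = b i a) (j : Fin n) : GermIn T (v j) := by
  have hsum : ∀ (s : Finset (Fin n)) (F : Fin n → V → ℂ) (hF : ∀ i, AnalyticAt ℂ (F i) x)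
      (hs : AnalyticAt ℂ (fun a => ∑ i ∈ s, F i a) x),
      toMero (fun a => ∑ i ∈ s, F i a) hs = ∑ i ∈ s, toMero (F i) (hF i) := by
    intro s F hF hs
    unfold toMero
    rw [← map_sum]
    congr 1
    apply Subtype.ext
    rw [AddSubmonoidClass.coe_finsetSum]
    dsimp only
    clear hs
    induction s using Finset.induction_on with
    | empty => rfl
    | insert i s hi ih => simp_rw [Finset.sum_insert hi]; rw [← ih]; rfl
  refine ⟨hv j, mem_subfield_of_linear_system T
    (Matrix.of fun i j => toMero (A i j) (hA i j).1) (fun i j => (hA i j).2) ?_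
    (fun i => toMero (b i) (hb i).1) (fun i => toMero (v i) (hv i)) (fun i => (hb i).2) ?_ j⟩
  · let R : holoGerms x := Matrix.det
      (Matrix.of fun i j => (⟨_, A i j, (hA i j).1, rfl⟩ : holoGerms x))
    have hR : algebraMap (holoGerms x) (MeroGerms x) R =
        Matrix.det (Matrix.of fun i j => toMero (A i j) (hA i j).1) := RingHom.map_det _ _
    rw [← hR, Ne, FaithfulSMul.algebraMap_eq_zero_iff]
    intro h0
    apply hdet
    -- Evaluation at `x` is a ring homomorphism, so a determinant germ with nonzero value at `x` is
    -- a nonzero germ.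
    let ev : holoGerms x →+* ℂ :=
      (Filter.Germ.valueRingHom : Filter.Germ (𝓝 x) ℂ →+* ℂ).comp (holoGerms x).subtype
    have := congrArg ev h0
    rw [map_zero, RingHom.map_det] at this
    exact this
  · intro i
    have hm : ∀ j, AnalyticAt ℂ (fun a => A i j a * v j a) x := fun j => (hA i j).1.mul (hv j)
    have := hsum Finset.univ (fun j a => A i j a * v j a) hm
      (Finset.analyticAt_fun_sum _ fun j _ => hm j)
    rw [← toMero_congr (Finset.analyticAt_fun_sum _ fun j _ => hm j) (hb i).1 (h i), this]
    exact Finset.sum_congr rfl fun j _ => (toMero_mul (hA i j).1 (hv j)).symm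

/-! ### The tower law for the transcendence degree. -/

section Degree

variable {X : Type*} [NormedAddCommGroup X] [NormedSpace ℂ X] {n : ℕ}

/-- The transcendence degree is the degree of the total extension. -/
theorem transcendenceDegree_eq (x₀ : X) (y₀ : Fin n → ℂ) {m : ℕ}
    (F : Fin m → X × (Fin n → ℂ) → ℂ) (hF : ∀ j, AnalyticAt ℂ (F j) (x₀, y₀)) :
    transcendenceDegree x₀ y₀ F hF = Cardinal.toENat (Subfield.relrank (baseField x₀ y₀)
      (Subfield.closure (baseField x₀ y₀ ∪ Set.range fun i => toMero (F i) (hF i)))) := by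
  let K := baseField x₀ y₀
  -- The tower is indexed by `ℕ` rather than `Fin m` so that its top `A m` is available and the
  -- product telescopes by induction.
  let A : ℕ → Subfield (MeroGerms (x₀, y₀)) := fun k =>
    Subfield.closure (K ∪ (fun i => toMero (F i) (hF i)) '' {i : Fin m | (i : ℕ) < k})
  have hmono : ∀ k l, k ≤ l → A k ≤ A l := fun k l h => Subfield.closure_mono
    (Set.union_subset_union_right _ (Set.image_mono fun i hi => lt_of_lt_of_le hi h))
  have hrange : Set.range (algebraMap K (MeroGerms (x₀, y₀))) = (K : Set _) := by
    ext a; simp [Subfield.algebraMap_ofSubfield]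
  have hadj : ∀ s : Set (MeroGerms (x₀, y₀)),
      (IntermediateField.adjoin K s).toSubfield = Subfield.closure (K ∪ s) := by
    intro s
    rw [← hrange]; rfl
  have key : ∀ k, k ≤ m → ∏ j ∈ Finset.range k,
      Cardinal.toENat (Subfield.relrank (A j) (A (j + 1))) =
      Cardinal.toENat (Subfield.relrank K (A k)) := by
    intro k
    induction k with
    | zero =>
      intro _
      have : A 0 = K := by simp [A]
      simp [this]
    | succ k ih =>
      intro hk
      rw [Finset.prod_range_succ, ih (by omega), ← map_mul, Subfield.relrank_mul_relrank]
      · exact fun a ha => Subfield.subset_closure (Or.inl ha)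
      · exact hmono _ _ (by omega)
  have hend : A m = Subfield.closure (K ∪ Set.range fun i => toMero (F i) (hF i)) := by
    simp only [A]
    congr 2
    rw [← Set.image_univ]
    congr 1
    ext i; simp
  rw [← hend, ← key m le_rfl, transcendenceDegree, Finset.prod_range]
  refine Finset.prod_congr rfl fun j _ => ?_
  rw [IntermediateField.relrank, hadj (_ '' Set.Iio j), hadj (_ '' Set.Iic j)]
  have h2 : Set.Iic j = {i : Fin m | (i : ℕ) < (j : ℕ) + 1} := by
    ext i; exact Nat.lt_succ_iff.symm
  rw [h2]
  rfl

end Degree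

/-! ### Holomorphic inverse and implicit function theorems. -/

section InverseFunction

variable {V W : Type*} [NormedAddCommGroup V] [NormedSpace ℂ V] [CompleteSpace V]
  [NormedAddCommGroup W] [NormedSpace ℂ W]

/-- The holomorphic inverse function theorem. -/
theorem exists_isBiholoGerm {f : V → W} {x : V} (hf : AnalyticAt ℂ f x) (e : V ≃L[ℂ] W)
    (he : fderiv ℂ f x = e) : ∃ ψ, IsBiholoGerm x (f x) f ψ := by
  have hs : HasStrictFDerivAt f (e : V →L[ℂ] W) x := he ▸ hf.hasStrictFDerivAt
  let φ := hs.toOpenPartialHomeomorph f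
  have hφ : (φ : V → W) = f := hs.toOpenPartialHomeomorph_coe
  have hx : x ∈ φ.source := hs.mem_toOpenPartialHomeomorph_source
  refine ⟨φ.symm, hf, rfl, ?_, ?_, ?_⟩
  · have := φ.analyticAt_symm' (i := e) hx (by rwa [hφ]) (by rw [hφ, he])
    rwa [hφ] at this
  · filter_upwards [φ.open_source.mem_nhds hx] with a ha
    rw [← hφ]; exact φ.left_inv ha
  · have : f x ∈ φ.target := by rw [← hφ]; exact φ.map_source hx
    filter_upwards [φ.open_target.mem_nhds this] with a ha
    rw [← hφ]; exact φ.right_inv ha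

/-- The holomorphic implicit function theorem for one equation. -/
theorem exists_implicit {R : ℂ × V → ℂ} (hR : AnalyticAt ℂ R 0) (hR0 : R 0 = 0)
    (hd : fderiv ℂ R 0 (1, 0) ≠ 0) :
    ∃ ρ : V → ℂ, AnalyticAt ℂ ρ 0 ∧ ∀ᶠ p in 𝓝 (0 : ℂ × V), R p = 0 ↔ p.1 = ρ p.2 := by
  set D := fderiv ℂ R 0 with hD
  set c := D (1, 0) with hc
  have hDp : ∀ p : ℂ × V, D p = p.1 * c + D (0, p.2) := by
    intro p
    have : p = p.1 • ((1 : ℂ), (0 : V)) + (0, p.2) := by ext <;> simp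
    conv_lhs => rw [this]
    rw [map_add, map_smul, smul_eq_mul]
  -- The differential of `(w, y) ↦ (R, y)` is block triangular with pivot `c`, so its inverse is
  -- explicit.
  let e : (ℂ × V) ≃L[ℂ] (ℂ × V) := ContinuousLinearEquiv.equivOfInverse
    (D.prod (ContinuousLinearMap.snd ℂ ℂ V))
    ((c⁻¹ • (ContinuousLinearMap.fst ℂ ℂ V -
      D.comp ((ContinuousLinearMap.inr ℂ ℂ V).comp (ContinuousLinearMap.snd ℂ ℂ V)))).prod
      (ContinuousLinearMap.snd ℂ ℂ V))
    (by
      intro p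
      ext
      · simp only [ContinuousLinearMap.prod_apply, _root_.smul_apply,
          _root_.sub_apply, ContinuousLinearMap.comp_apply,
          ContinuousLinearMap.coe_fst', ContinuousLinearMap.coe_snd',
          ContinuousLinearMap.inr_apply, smul_eq_mul]
        rw [hDp p]
        field_simp
        ring
      · simp)
    (by
      intro p
      ext
      · simp only [ContinuousLinearMap.prod_apply, _root_.smul_apply,
          _root_.sub_apply, ContinuousLinearMap.comp_apply,
          ContinuousLinearMap.coe_fst', ContinuousLinearMap.coe_snd',
          ContinuousLinearMap.inr_apply, smul_eq_mul]
        rw [hDp]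
        field_simp
        ring
      · simp)
  have hT : AnalyticAt ℂ (fun p : ℂ × V => (R p, p.2)) 0 := hR.prod analyticAt_snd
  obtain ⟨ψ, hψ⟩ := exists_isBiholoGerm hT e (by
    have h1 : HasFDerivAt (fun p : ℂ × V => (R p, p.2))
        (D.prod (ContinuousLinearMap.snd ℂ ℂ V)) 0 :=
      hR.differentiableAt.hasFDerivAt.prodMk hasFDerivAt_snd
    rw [h1.fderiv]; rfl)
  have hb : (R 0, (0 : ℂ × V).2) = 0 := by simp [hR0]
  rw [hb] at hψ
  have hι : AnalyticAt ℂ (fun y : V => ((0 : ℂ), y)) 0 := analyticAt_const.prod analyticAt_id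
  have hιt : Filter.Tendsto (fun p : ℂ × V => ((0 : ℂ), p.2)) (𝓝 0) (𝓝 0) := by
    have : ContinuousAt (fun p : ℂ × V => ((0 : ℂ), p.2)) 0 := by fun_prop
    exact this.tendsto
  -- The inverse of `(w, y) ↦ (R, y)` at `(0, y)` is the point of `{R = 0}` over `y`.
  refine ⟨fun y => (ψ (0, y)).1, ?_, ?_⟩
  · exact analyticAt_fst.comp (AnalyticAt.comp (f := fun y : V => ((0 : ℂ), y)) (x := 0)
      hψ.analytic_symm hι)
  · filter_upwards [hψ.left_inv, hιt.eventually hψ.right_inv] with p h1 h2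
    constructor
    · intro h0
      rw [h0] at h1
      rw [h1]
    · intro h0
      have h3 := congrArg Prod.snd h2
      have h4 := congrArg Prod.fst h2
      dsimp only at h3 h4
      have : ψ (0, p.2) = p := Prod.ext h0.symm h3
      rwa [this] at h4

end InverseFunction

/-! ### Holomorphy of conjugated functions. -/

section Conjugation

variable {E F : Type*} [NormedAddCommGroup E] [NormedSpace ℂ E] [StarAddMonoid E]
  [NormedStarGroup E] [StarModule ℂ E] [NormedAddCommGroup F] [NormedSpace ℂ F] [StarAddMonoid F]
  [NormedStarGroup F] [StarModule ℂ F]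

/-- The conjugate of a continuous multilinear map. -/
def conjMultilinear {k : ℕ} (p : ContinuousMultilinearMap ℂ (fun _ : Fin k => E) F) :
    ContinuousMultilinearMap ℂ (fun _ : Fin k => E) F where
  toFun m := star (p fun i => star (m i))
  map_update_add' := by
    intro _ m i x y
    have h : ∀ x : E, (fun j => star (Function.update m i x j)) =
        Function.update (fun j => star (m j)) i (star x) := by
      intro x; ext j; by_cases hj : j = i
      · subst hj; simp
      · simp [hj]
    have := p.map_update_add (fun j => star (m j)) i (star x) (star y)
    rw [h, h, h, star_add, this, star_add]
  map_update_smul' := by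
    intro _ m i c x
    have h : ∀ x : E, (fun j => star (Function.update m i x j)) =
        Function.update (fun j => star (m j)) i (star x) := by
      intro x; ext j; by_cases hj : j = i
      · subst hj; simp
      · simp [hj]
    have := p.map_update_smul (fun j => star (m j)) i (star c) (star x)
    rw [h, h, star_smul, this, star_smul, star_star]
  cont := by
    refine continuous_star.comp (p.cont.comp ?_)
    exact continuous_pi fun i => continuous_star.comp (continuous_apply i)

theorem norm_conjMultilinear_le {k : ℕ}
    (p : ContinuousMultilinearMap ℂ (fun _ : Fin k => E) F) : ‖conjMultilinear p‖ ≤ ‖p‖ := by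
  refine ContinuousMultilinearMap.opNorm_le_bound (norm_nonneg _) fun m => ?_
  change ‖star (p fun i => star (m i))‖ ≤ _
  rw [norm_star]
  simpa using p.le_opNorm fun i => star (m i)

/-- Conjugates of holomorphic functions are holomorphic. -/
theorem analyticAt_star_star {f : E → F} {x : E} (hf : AnalyticAt ℂ f (star x)) :
    AnalyticAt ℂ (fun y => star (f (star y))) x := by
  obtain ⟨p, r, hp⟩ := hf
  -- The conjugated coefficients have no larger norm, so the series converges on the same ball.
  refine ⟨fun k => conjMultilinear (p k), r, ?_, hp.r_pos, ?_⟩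
  · exact hp.r_le.trans
      (FormalMultilinearSeries.radius_le_of_le fun k => norm_conjMultilinear_le (p k))
  · intro y hy
    have hy' : star y ∈ Metric.eball (0 : E) r := by
      rw [Metric.mem_eball, edist_zero_right, ← ofReal_norm] at hy ⊢
      rwa [norm_star]
    have := (hp.hasSum hy').star
    simpa using! this

end Conjugation

/-! ### Polarization of real-analytic functions and uniqueness on the conjugate diagonal. -/

section Complexification

/-- A real-analytic function on `ℝ^ι` extends to a holomorphic function on `ℂ^ι`. -/
theorem exists_holomorphic_extension {ι : Type*} [Fintype ι] {f : (ι → ℝ) → ℝ}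
    (hf : AnalyticAt ℝ f 0) :
    ∃ F : (ι → ℂ) → ℂ, AnalyticAt ℂ F 0 ∧
      ∀ᶠ x in 𝓝 (0 : ι → ℝ), F (fun i => (x i : ℂ)) = f x := by
  classical
  obtain ⟨p, r, hp⟩ := hf
  obtain ⟨C, a, hC, ha, hCa⟩ := p.le_mul_pow_of_radius_pos (hp.r_pos.trans_le hp.r_le)
  -- Each `p k` is expanded on the standard basis and the real coordinates are replaced by complex
  -- ones. There are `|ι| ^ k` terms of size at most `C * a ^ k`, so the radius stays positive.
  let P : FormalMultilinearSeries ℂ (ι → ℂ) ℂ := fun k =>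
    ∑ v : Fin k → ι, ((p k fun j => Pi.single (v j) 1 : ℝ) : ℂ) •
      (ContinuousMultilinearMap.mkPiAlgebra ℂ (Fin k) ℂ).compContinuousLinearMap
        fun j => ContinuousLinearMap.proj (v j)
  have hPapp : ∀ k (m : Fin k → ι → ℂ), P k m =
      ∑ v : Fin k → ι, ((p k fun j => Pi.single (v j) 1 : ℝ) : ℂ) * ∏ j, m j (v j) := by
    intro k m
    simp [P]
  have hPnorm : ∀ k, ‖P k‖ ≤ C * (Fintype.card ι * a) ^ k := by
    intro k
    refine ContinuousMultilinearMap.opNorm_le_bound (by positivity) fun m => ?_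
    rw [hPapp]
    have hterm : ∀ v : Fin k → ι,
        ‖((p k fun j => Pi.single (v j) 1 : ℝ) : ℂ) * ∏ j, m j (v j)‖ ≤
          C * a ^ k * ∏ j, ‖m j‖ := by
      intro v
      rw [norm_mul, norm_prod, Complex.norm_real]
      have h1 : ‖p k fun j => Pi.single (v j) (1 : ℝ)‖ ≤ C * a ^ k := by
        refine ((p k).le_opNorm _).trans ?_
        simp only [Pi.norm_single, norm_one, Finset.prod_const_one, mul_one]
        exact hCa k
      exact mul_le_mul h1 (Finset.prod_le_prod (fun j _ => norm_nonneg _)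
        fun j _ => norm_le_pi_norm (m j) (v j)) (Finset.prod_nonneg fun j _ => norm_nonneg _)
        (by positivity)
    refine (norm_sum_le _ _).trans ((Finset.sum_le_sum fun v _ => hterm v).trans (le_of_eq ?_))
    simp only [Finset.sum_const, Finset.card_univ, Fintype.card_fun, Fintype.card_fin,
      nsmul_eq_mul, Nat.cast_pow, mul_pow]
    ring
  have hrad : 0 < P.radius := by
    -- The summand `1` keeps the denominator positive when `ι` is empty.
    let b : NNReal := ⟨(Fintype.card ι * a + 1)⁻¹, by positivity⟩
    have hb : (0 : NNReal) < b := by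
      rw [← NNReal.coe_pos]; change (0 : ℝ) < (Fintype.card ι * a + 1)⁻¹; positivity
    refine lt_of_lt_of_le (ENNReal.coe_pos.2 hb) (P.le_radius_of_bound C fun k => ?_)
    change ‖P k‖ * ((Fintype.card ι * a + 1)⁻¹) ^ k ≤ C
    have h0 : (0 : ℝ) ≤ Fintype.card ι * a := by positivity
    calc ‖P k‖ * ((Fintype.card ι * a + 1)⁻¹) ^ k
        ≤ C * (Fintype.card ι * a) ^ k * ((Fintype.card ι * a + 1)⁻¹) ^ k := by
          gcongr; exact hPnorm k
      _ = C * ((Fintype.card ι * a) * (Fintype.card ι * a + 1)⁻¹) ^ k := by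
          rw [mul_pow]; ring
      _ ≤ C * 1 := by
          gcongr
          refine pow_le_one₀ (by positivity) ?_
          rw [← div_eq_mul_inv, div_le_one (by positivity)]
          linarith
      _ = C := mul_one C
  have hP := P.hasFPowerSeriesOnBall hrad
  refine ⟨P.sum, hP.analyticAt, ?_⟩
  have hcont : Filter.Tendsto (fun x : ι → ℝ => fun i => (x i : ℂ)) (𝓝 0) (𝓝 0) := by
    have : ContinuousAt (fun x : ι → ℝ => fun i => (x i : ℂ)) 0 :=
      (continuous_pi fun i => Complex.continuous_ofReal.comp (continuous_apply i)).continuousAt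
    have h := this.tendsto
    convert h using 2
    ext i; simp
  filter_upwards [hcont.eventually (Metric.eball_mem_nhds (0 : ι → ℂ) hrad),
    Metric.eball_mem_nhds (0 : ι → ℝ) hp.r_pos] with x h1 h2
  have s1 := hP.hasSum h1
  have s2 := (Complex.hasSum_ofReal.2 (hp.hasSum h2))
  simp only [zero_add] at s1 s2
  suffices hk : ∀ k, P k (fun _ i => (x i : ℂ)) = ((p k fun _ => x : ℝ) : ℂ) by
    simp only [hk] at s1
    exact s1.unique s2
  intro k
  rw [hPapp]
  have hx : x = ∑ i, x i • Pi.single (M := fun _ : ι => ℝ) i 1 := by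
    ext i; simp [Finset.sum_apply, Pi.single_apply]
  have h3 := (p k).map_sum (fun (_ : Fin k) (i : ι) => x i • Pi.single (M := fun _ : ι => ℝ) i 1)
  simp only [← hx] at h3
  rw [h3]
  push_cast
  refine Finset.sum_congr rfl fun v _ => ?_
  rw [(p k).map_smul_univ (fun j => x (v j)) fun j => Pi.single (v j) 1]
  simp [mul_comm]

variable {E : Type*} [NormedAddCommGroup E] [NormedSpace ℂ E] [StarAddMonoid E]
  [NormedStarGroup E] [StarModule ℂ E]

/-- A real-analytic function `r` on a complex vector space is `R (x, x̄)` with `R` holomorphic. -/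
theorem exists_polarization [NormedSpace ℝ E] [IsScalarTower ℝ ℂ E] [FiniteDimensional ℝ E]
    {r : E → ℝ} (hr : AnalyticAt ℝ r 0) :
    ∃ R : E × E → ℂ, AnalyticAt ℂ R 0 ∧ ∀ᶠ x in 𝓝 (0 : E), R (x, star x) = r x := by
  have : FiniteDimensional ℂ E := FiniteDimensional.right ℝ ℂ E
  let e : E ≃L[ℝ] (Fin (Module.finrank ℝ E) → ℝ) :=
    (Module.finBasis ℝ E).equivFun.toContinuousLinearEquiv
  have hre : AnalyticAt ℝ (r ∘ e.symm) 0 :=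
    AnalyticAt.comp (by simpa using hr) (e.symm.toContinuousLinearMap.analyticAt 0)
  obtain ⟨F, hF, hFr⟩ := exists_holomorphic_extension hre
  let l : Fin (Module.finrank ℝ E) → E →ₗ[ℂ] ℂ := fun i =>
    Module.Dual.extendRCLike ((LinearMap.proj i).comp e.toLinearEquiv.toLinearMap)
  have hl : ∀ i x, (l i x).re = e x i := fun i x =>
    Module.Dual.re_extendRCLike_apply (𝕜 := ℂ)
      ((LinearMap.proj i).comp e.toLinearEquiv.toLinearMap) x
  -- Since `l i` is complex linear with real part the `i`-th real coordinate, `Λ` is holomorphic and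
  -- restricts to the real coordinates on the conjugate diagonal.
  let Λ : E × E → Fin (Module.finrank ℝ E) → ℂ := fun y i =>
    (1 / 2 : ℂ) * (l i y.1 + star (l i (star y.2)))
  have hla : ∀ i x, AnalyticAt ℂ (l i) x := fun i x =>
    (LinearMap.toContinuousLinearMap (l i)).analyticAt x
  have hΛ : AnalyticAt ℂ Λ 0 := by
    rw [analyticAt_pi_iff]
    intro i
    refine analyticAt_const.mul (AnalyticAt.add ?_ ?_)
    · exact (hla i _).comp analyticAt_fst
    · exact AnalyticAt.comp (g := fun y => star (l i (star y)))
        (analyticAt_star_star (hla i _)) analyticAt_snd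
  have hΛ0 : Λ 0 = 0 := by ext i; simp [Λ]
  refine ⟨F ∘ Λ, AnalyticAt.comp (by rwa [hΛ0]) hΛ, ?_⟩
  have het : Filter.Tendsto e (𝓝 0) (𝓝 0) := by
    simpa using e.continuous.tendsto 0
  filter_upwards [het.eventually hFr] with x hx
  have : Λ (x, star x) = fun i => ((e x i : ℝ) : ℂ) := by
    ext i
    have := Complex.add_conj (l i x)
    simp only [Λ, star_star, ← hl]
    change _ * (l i x + (starRingEnd ℂ) (l i x)) = _
    rw [this]; push_cast; ring
  simp only [Function.comp_apply, this, hx]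
  simp

/-- A holomorphic function vanishing on the conjugate diagonal vanishes. -/
theorem eventually_zero_of_conj_diagonal {F : E × E → ℂ} (hF : AnalyticAt ℂ F 0)
    (h : ∀ᶠ x in 𝓝 (0 : E), F (x, star x) = 0) : ∀ᶠ y in 𝓝 (0 : E × E), F y = 0 := by
  obtain ⟨ε, hε, hb⟩ := Metric.eventually_nhds_iff_ball.1 hF.eventually_analyticAt
  obtain ⟨δ, hδ, hd⟩ := Metric.eventually_nhds_iff_ball.1 h
  -- This bound keeps `a + c b` and `ā + c b̄` inside both balls for all `|c| < 2`, a disc that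
  -- contains `i`.
  have hm : 0 < min ε δ / 6 := by positivity
  filter_upwards [Metric.ball_mem_nhds (0 : E × E) hm] with y hy
  rw [mem_ball_zero_iff, Prod.norm_def, max_lt_iff] at hy
  set a : E := (1 / 2 : ℂ) • (y.1 + star y.2) with ha
  set b : E := (-(Complex.I / 2) : ℂ) • (y.1 - star y.2) with hbdef
  have hna : ‖a‖ < min ε δ / 6 := by
    calc ‖a‖ ≤ ‖(1 / 2 : ℂ)‖ * (‖y.1‖ + ‖y.2‖) := by
          rw [ha, norm_smul]; gcongr
          exact (norm_add_le _ _).trans (by rw [norm_star])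
      _ < min ε δ / 6 := by norm_num; linarith
  have hnb : ‖b‖ < min ε δ / 6 := by
    calc ‖b‖ ≤ ‖(-(Complex.I / 2) : ℂ)‖ * (‖y.1‖ + ‖y.2‖) := by
          rw [hbdef, norm_smul]; gcongr
          exact (norm_sub_le _ _).trans (by rw [norm_star])
      _ < min ε δ / 6 := by norm_num; linarith
  have hbd : ∀ (c : ℂ) (u v : E), ‖c‖ < 2 → ‖u‖ < min ε δ / 6 → ‖v‖ < min ε δ / 6 →
      ‖u + c • v‖ < min ε δ := by
    intro c u v hc hu hv
    calc ‖u + c • v‖ ≤ ‖u‖ + ‖c‖ * ‖v‖ := (norm_add_le _ _).trans (by rw [norm_smul])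
      _ ≤ ‖u‖ + 2 * ‖v‖ := by gcongr
      _ < min ε δ := by linarith
  -- The complex line through `(a, ā)` in direction `(b, b̄)` meets the conjugate diagonal at real
  -- parameters and passes through `y` at `c = i`. The one-variable identity theorem carries the
  -- zeros from real `c` to `i`.
  let φ : ℂ → ℂ := fun c => F (a + c • b, star a + c • star b)
  have hφ : AnalyticOnNhd ℂ φ (Metric.ball 0 2) := by
    intro c hc
    rw [mem_ball_zero_iff] at hc
    refine AnalyticAt.comp (f := fun c : ℂ => (a + c • b, star a + c • star b)) (hb _ ?_) ?_
    · rw [mem_ball_zero_iff, Prod.norm_def, max_lt_iff]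
      exact ⟨(hbd c a b hc hna hnb).trans_le (min_le_left _ _),
        (hbd c _ _ hc (by rwa [norm_star]) (by rwa [norm_star])).trans_le (min_le_left _ _)⟩
    · exact (analyticAt_const.add (analyticAt_id.smul analyticAt_const)).prod
        (analyticAt_const.add (analyticAt_id.smul analyticAt_const))
  have hreal : ∀ t : ℝ, |t| < 2 → φ t = 0 := by
    intro t ht
    have h1 : star (a + (t : ℂ) • b) = star a + (t : ℂ) • star b := by
      rw [star_add, star_smul]; simp
    have : ‖(t : ℂ)‖ < 2 := by simpa using ht
    have h2 := hd (a + (t : ℂ) • b) (by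
      rw [mem_ball_zero_iff]
      exact (hbd _ a b this hna hnb).trans_le (min_le_right _ _))
    rw [h1] at h2
    exact h2
  have hfreq : ∃ᶠ c in 𝓝[≠] (0 : ℂ), φ c = 0 := by
    have ht : Filter.Tendsto (fun k : ℕ => (((1 : ℝ) / ((k : ℝ) + 1) : ℝ) : ℂ)) Filter.atTop
        (𝓝[≠] 0) := by
      refine tendsto_nhdsWithin_iff.2 ⟨?_, ?_⟩
      · have := (Complex.continuous_ofReal.tendsto 0).comp
          (tendsto_one_div_add_atTop_nhds_zero_nat (𝕜 := ℝ))
        simpa [Function.comp_def] using this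
      · refine Filter.Eventually.of_forall fun k => ?_
        have : (0 : ℝ) < 1 / ((k : ℝ) + 1) := by positivity
        simpa using by exact_mod_cast Nat.succ_ne_zero k
    refine ht.frequently (Filter.Frequently.of_forall fun k => hreal _ ?_)
    rw [abs_of_pos (by positivity)]
    have : (1 : ℝ) / ((k : ℝ) + 1) ≤ 1 := by
      rw [div_le_one (by positivity)]; linarith [(Nat.cast_nonneg k : (0 : ℝ) ≤ k)]
    linarith
  have hz := hφ.eqOn_zero_of_preconnected_of_frequently_eq_zero
    (convex_ball (0 : ℂ) 2).isPreconnected (by simp) hfreq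
  have hI := hz (x := Complex.I) (by simp)
  have e1 : a + Complex.I • b = y.1 := by
    rw [ha, hbdef, smul_smul]
    have : Complex.I * -(Complex.I / 2) = 1 / 2 := by
      rw [mul_neg, mul_div_assoc', Complex.I_mul_I]; norm_num
    rw [this, ← smul_add, add_add_sub_cancel, ← two_smul ℂ, smul_smul]
    norm_num
  have e2 : star a + Complex.I • star b = y.2 := by
    rw [ha, hbdef, star_smul, star_smul, smul_smul]
    have : Complex.I * star (-(Complex.I / 2)) = -(1 / 2) := by
      simp [mul_div_assoc', Complex.I_mul_I]
    rw [this, star_add, star_sub, star_star, neg_smul]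
    have h2 : star (1 / 2 : ℂ) = 1 / 2 := by simp
    rw [h2, ← sub_eq_add_neg, ← smul_sub, add_sub_sub_cancel, ← two_smul ℂ, smul_smul]
    norm_num
  simpa [φ, e1, e2] using hI

end Complexification

theorem real_smul_eq {E : Type*} [NormedAddCommGroup E] [NormedSpace ℂ E] [NormedSpace ℝ E]
    [IsScalarTower ℝ ℂ E] (c : ℝ) (x : E) : c • x = (c : ℂ) • x :=
  (algebraMap_smul ℂ c x).symm

section ConjContinuity

variable {E : Type*} [NormedAddCommGroup E] [StarAddMonoid E] [NormedStarGroup E]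

theorem tendsto_conjDiag : Filter.Tendsto (fun x : E => (x, star x)) (𝓝 0) (𝓝 (0 : E × E)) := by
  have : ContinuousAt (fun x : E => (x, star x)) 0 := by fun_prop
  simpa [ContinuousAt, Prod.mk_zero_zero] using this.tendsto

theorem tendsto_conjSwap :
    Filter.Tendsto (fun y : E × E => (star y.2, star y.1)) (𝓝 0) (𝓝 (0 : E × E)) := by
  have : ContinuousAt (fun y : E × E => (star y.2, star y.1)) 0 := by fun_prop
  simpa [ContinuousAt, Prod.mk_zero_zero] using this.tendsto

end ConjContinuity

/-! ### Derivatives of a polarization, and vanishing on the complexification. -/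

section Straightening

variable {E : Type*} [NormedAddCommGroup E] [NormedSpace ℂ E] [StarAddMonoid E]
  [NormedStarGroup E] [StarModule ℂ E]

/-- The real-linear embedding `x ↦ (x, x̄)` as the conjugate diagonal. -/
def conjDiag [NormedSpace ℝ E] [IsScalarTower ℝ ℂ E] : E →L[ℝ] E × E where
  toFun x := (x, star x)
  map_add' x y := by ext <;> simp
  map_smul' c x := by
    ext
    · simp
    · simp only [real_smul_eq, star_smul, RingHom.id_apply, Prod.smul_snd]
      simp
  cont := by fun_prop

/-- Reflection principle: a holomorphic function which is real on the conjugate diagonal is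
symmetric with respect to it. -/
theorem eventually_conjSwap {R : E × E → ℂ} (hR : AnalyticAt ℂ R 0)
    (h : ∀ᶠ x in 𝓝 (0 : E), star (R (x, star x)) = R (x, star x)) :
    ∀ᶠ y in 𝓝 (0 : E × E), R (star y.2, star y.1) = star (R y) := by
  have : NormedStarGroup (E × E) := ⟨fun y => by simp [Prod.norm_def]⟩
  have hsw : AnalyticAt ℂ (fun y : E × E => R (y.2, y.1)) (star 0) := by
    refine AnalyticAt.comp (f := fun y : E × E => (y.2, y.1)) (by simpa [Prod.mk_zero_zero] using hR)
      (analyticAt_snd.prod analyticAt_fst)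
  have h1 : AnalyticAt ℂ (fun y : E × E => star (R ((star y).2, (star y).1))) 0 :=
    analyticAt_star_star (f := fun y : E × E => R (y.2, y.1)) hsw
  -- The conjugate of `R` at the swapped conjugate point is holomorphic and agrees with `R` on the
  -- conjugate diagonal.
  have := eventually_zero_of_conj_diagonal (h1.sub hR) (by
    filter_upwards [h] with x hx
    simpa using sub_eq_zero.2 hx)
  filter_upwards [this] with y hy
  have h2 : star (R (star y.2, star y.1)) = R y := sub_eq_zero.1 hy
  rw [← h2, star_star]

variable [NormedSpace ℝ E] [IsScalarTower ℝ ℂ E] {r : E → ℝ} {R : E × E → ℂ}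

/-- Chain rule along the real-linear embedding `x ↦ (x, x̄)`, with uniqueness of the real
derivative. -/
theorem fderiv_polarization {x : E} (hR : AnalyticAt ℂ R (x, star x))
    (hd : DifferentiableAt ℝ r x) (h : ∀ᶠ y in 𝓝 x, R (y, star y) = r y) (v : E) :
    fderiv ℂ R (x, star x) (v, star v) = fderiv ℝ r x v := by
  have h1 : HasFDerivAt (fun y => R (conjDiag y))
      (((fderiv ℂ R (x, star x)).restrictScalars ℝ).comp conjDiag) x :=
    HasFDerivAt.comp x (hR.differentiableAt.hasFDerivAt.restrictScalars ℝ)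
      (conjDiag (E := E)).hasFDerivAt
  have h2 : HasFDerivAt (fun x => (r x : ℂ)) (Complex.ofRealCLM.comp (fderiv ℝ r x)) x :=
    Complex.ofRealCLM.hasFDerivAt.comp _ hd.hasFDerivAt
  have h3 := h1.unique (h2.congr_of_eventuallyEq h)
  simpa [conjDiag] using congrArg (fun A => A v) h3

theorem fderiv_polarization_zero (hR : AnalyticAt ℂ R 0) (hd : DifferentiableAt ℝ r 0)
    (h : ∀ᶠ x in 𝓝 (0 : E), R (x, star x) = r x) (v : E) :
    fderiv ℂ R 0 (v, star v) = fderiv ℝ r 0 v := by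
  have h0 : ((0 : E), star (0 : E)) = 0 := by simp [Prod.mk_zero_zero]
  have := fderiv_polarization (x := 0) (h0.symm ▸ hR) hd h v
  rwa [h0] at this

/-- The second derivatives of a function and of its polarization. -/
theorem fderiv_fderiv_polarization (hR : AnalyticAt ℂ R 0) (hr : AnalyticAt ℝ r 0)
    (h : ∀ᶠ x in 𝓝 (0 : E), R (x, star x) = r x) (u v : E) :
    fderiv ℂ (fderiv ℂ R) 0 (u, star u) (v, star v) = fderiv ℝ (fderiv ℝ r) 0 u v := by
  -- The first-order identity at nearby points says that `dR (v, v̄)` polarizes `dr v`, so it can be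
  -- applied a second time.
  have h1 : ∀ᶠ x in 𝓝 (0 : E), fderiv ℂ R (x, star x) (v, star v) = fderiv ℝ r x v := by
    filter_upwards [h.eventually_nhds, tendsto_conjDiag.eventually hR.eventually_analyticAt,
      hr.eventually_analyticAt] with x hx1 hx2 hx3
    exact fderiv_polarization hx2 hx3.differentiableAt hx1 v
  have hR2 := hR.fderiv
  have hr2 := hr.fderiv
  have e1 : fderiv ℂ (fun y => fderiv ℂ R y (v, star v)) 0 (u, star u) =
      fderiv ℂ (fderiv ℂ R) 0 (u, star u) (v, star v) := by
    rw [fderiv_clm_apply hR2.differentiableAt (differentiableAt_const _)]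
    simp
  have e2 : fderiv ℝ (fun y => fderiv ℝ r y v) 0 u = fderiv ℝ (fderiv ℝ r) 0 u v := by
    rw [fderiv_clm_apply hr2.differentiableAt (differentiableAt_const _)]
    simp
  rw [← e1, ← e2]
  exact fderiv_polarization_zero
    ((ContinuousLinearMap.apply ℂ ℂ (v, star v)).analyticAt _ |>.comp hR2)
    (hr2.differentiableAt.clm_apply (differentiableAt_const _)) h1 u

/-- A holomorphic function which vanishes at the points `(x, x̄)` with `r x = 0` vanishes on the
complexification `{R = 0}` of `{r = 0}`, and its differential at `0` is a multiple of that
of `R`. -/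
theorem vanish_on_complexification [CompleteSpace E] (hR : AnalyticAt ℂ R 0) (hR0 : R 0 = 0)
    (hd : DifferentiableAt ℝ r 0) (h : ∀ᶠ x in 𝓝 (0 : E), R (x, star x) = r x)
    (hr : fderiv ℝ r 0 ≠ 0) {H : E × E → ℂ} (hH : AnalyticAt ℂ H 0)
    (hz : ∀ᶠ x in 𝓝 (0 : E), r x = 0 → H (x, star x) = 0) :
    (∀ᶠ y in 𝓝 (0 : E × E), R y = 0 → H y = 0) ∧
      ∀ u, fderiv ℂ R 0 u = 0 → fderiv ℂ H 0 u = 0 := by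
  set l := fderiv ℂ R 0 with hl
  have hlr : ∀ v, l (v, star v) = fderiv ℝ r 0 v := fderiv_polarization_zero hR hd h
  obtain ⟨v, hv⟩ : ∃ v, fderiv ℝ r 0 v = 1 := by
    obtain ⟨v, hv⟩ := DFunLike.ne_iff.1 hr
    refine ⟨(fderiv ℝ r 0 v)⁻¹ • v, ?_⟩
    rw [map_smul, smul_eq_mul, inv_mul_cancel₀ hv]
  set v₀ : E × E := (v, star v) with hv₀
  have hlv : l v₀ = 1 := by rw [hv₀, hlr, hv]; simp
  -- `χ` is tangent to the identity and satisfies `l ∘ χ = R`: it flattens `{R = 0}` to the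
  -- hyperplane `{l = 0}`.
  let χ : E × E → E × E := fun y => y + (R y - l y) • v₀
  have hχa : AnalyticAt ℂ χ 0 :=
    analyticAt_id.add ((hR.sub (l.analyticAt 0)).smul analyticAt_const)
  have hχd : fderiv ℂ χ 0 = (ContinuousLinearEquiv.refl ℂ (E × E) : E × E →L[ℂ] E × E) := by
    have h1 : HasFDerivAt χ (ContinuousLinearMap.id ℂ (E × E) + (l - l).smulRight v₀) 0 :=
      (hasFDerivAt_id _).add
        ((hR.differentiableAt.hasFDerivAt.sub l.hasFDerivAt).smul_const v₀)
    rw [h1.fderiv]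
    ext <;> simp
  obtain ⟨ψ, hψ⟩ := exists_isBiholoGerm hχa _ hχd
  have hχ0 : χ 0 = 0 := by simp [χ, hR0]
  rw [hχ0] at hψ
  have hlχ : ∀ y, l (χ y) = R y := by intro y; simp [χ, hlv]
  -- Because `R` and `l` are real on the conjugate diagonal and `v₀` lies in it, `χ` commutes with
  -- the conjugation. Its inverse `ψ` therefore preserves the diagonal.
  have hreal : ∀ᶠ y in 𝓝 (0 : E × E), χ (star y.2, star y.1) = (star (χ y).2, star (χ y).1) := by
    have h1 := eventually_conjSwap hR (by
      filter_upwards [h] with x hx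
      rw [hx]; simp)
    have h2 := eventually_conjSwap (l.analyticAt 0) (by
      refine Filter.Eventually.of_forall fun x => ?_
      rw [hlr]; simp)
    filter_upwards [h1, h2] with y h1 h2
    simp only [χ, h1, h2, hv₀]
    ext <;> simp [star_smul]
  have hψreal : ∀ᶠ x in 𝓝 (0 : E), ψ (x, star x) = ((ψ (x, star x)).1, star (ψ (x, star x)).1) := by
    have t1 := tendsto_conjDiag (E := E)
    have t2 := hψ.symm.tendsto.comp t1
    filter_upwards [t1.eventually hψ.right_inv, t2.eventually hreal,
      (tendsto_conjSwap.comp t2).eventually hψ.left_inv] with x h1 h2 h3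
    simp only [Function.comp_apply] at h2 h3
    rw [h1] at h2
    simp only [star_star] at h2
    rw [h2] at h3
    have h4 := congrArg Prod.snd h3
    exact Prod.ext rfl h4
  -- `P` projects onto `{l = 0}` along `v₀` and preserves the conjugate diagonal. There `ψ ∘ P`
  -- lands at points `(x, x̄)` with `r x = 0`, so `H ∘ ψ ∘ P` vanishes on the diagonal, hence
  -- identically.
  let P : E × E →L[ℂ] E × E := ContinuousLinearMap.id ℂ _ - l.smulRight v₀
  have hP : ∀ y, P y = y - l y • v₀ := fun y => rfl
  have hlP : ∀ y, l (P y) = 0 := by intro y; simp [hP, hlv]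
  have hPa : AnalyticAt ℂ (fun y => H (ψ (P y))) 0 := by
    refine AnalyticAt.comp (g := H) (f := fun y => ψ (P y)) ?_ ?_
    · simpa [hψ.map_base_symm] using hH
    · exact AnalyticAt.comp (g := ψ) (by simpa using hψ.analytic_symm) (P.analyticAt 0)
  have hPz : ∀ᶠ y in 𝓝 (0 : E × E), H (ψ (P y)) = 0 := by
    refine eventually_zero_of_conj_diagonal hPa ?_
    let Q : E → E := fun x => x - fderiv ℝ r 0 x • v
    have hPQ : ∀ x, P (x, star x) = (Q x, star (Q x)) := by
      intro x
      rw [hP, hlr, hv₀]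
      ext
      · simp only [Q, real_smul_eq]; rfl
      · simp only [Q, real_smul_eq, star_sub, star_smul, Prod.snd_sub, Prod.smul_snd]
        simp
    have hQt : Filter.Tendsto Q (𝓝 0) (𝓝 0) := by
      have : ContinuousAt Q 0 := by fun_prop
      simpa [ContinuousAt, Q] using this.tendsto
    have t2 : Filter.Tendsto (fun x => (ψ (Q x, star (Q x))).1) (𝓝 0) (𝓝 0) :=
      (continuous_fst.tendsto (0 : E × E)).comp
        (hψ.symm.tendsto.comp (tendsto_conjDiag.comp hQt))
    filter_upwards [hQt.eventually hψreal, (tendsto_conjDiag.comp hQt).eventually hψ.right_inv,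
      t2.eventually hz, t2.eventually h] with x h1 h2 h3 h4
    simp only [Function.comp_apply] at h2
    rw [hPQ, h1]
    apply h3
    rw [← h1, ← hlχ, h2, ← hPQ, hlP, hPQ] at h4
    exact_mod_cast h4.symm
  constructor
  · filter_upwards [hψ.left_inv, hψ.tendsto.eventually hPz] with y h1 h2 h3
    have : P (χ y) = χ y := by rw [hP, hlχ, h3]; simp
    rwa [this, h1] at h2
  · intro u hu
    -- With `dψ = id` at `0`, differentiating `H ∘ ψ ∘ P = 0` gives `dH ∘ P = 0`, and `P u = u` when
    -- `l u = 0`.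
    have hψd : HasFDerivAt ψ (ContinuousLinearMap.id ℂ (E × E)) 0 := by
      have h1 : HasFDerivAt χ (ContinuousLinearMap.id ℂ (E × E)) 0 := by
        have := hχa.differentiableAt.hasFDerivAt
        rw [hχd] at this
        exact this
      have h2 : HasFDerivAt ψ (fderiv ℂ ψ 0) (χ 0) := by
        rw [hχ0]; exact hψ.analytic_symm.differentiableAt.hasFDerivAt
      have h3 := (h2.comp (0 : E × E) h1).unique
        ((hasFDerivAt_id (𝕜 := ℂ) (0 : E × E)).congr_of_eventuallyEq hψ.left_inv)
      have h4 : fderiv ℂ ψ 0 = ContinuousLinearMap.id ℂ (E × E) := h3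
      rw [← h4]
      exact hψ.analytic_symm.differentiableAt.hasFDerivAt
    have h1 : HasFDerivAt (fun y => H (ψ (P y)))
        ((fderiv ℂ H 0).comp ((ContinuousLinearMap.id ℂ (E × E)).comp P)) 0 := by
      refine HasFDerivAt.comp (0 : E × E) (g := H) ?_
        (HasFDerivAt.comp (0 : E × E) (g := ψ) ?_ P.hasFDerivAt)
      · rw [map_zero, hψ.map_base_symm]
        exact hH.differentiableAt.hasFDerivAt
      · rw [map_zero]; exact hψd
    have h2 := h1.unique ((hasFDerivAt_const (0 : ℂ) (0 : E × E)).congr_of_eventuallyEq hPz)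
    have h3 := congrArg (fun A => A u) h2
    simpa [hP, hu] using h3

end Straightening

/-! ### Complexifications of Levi-nondegenerate hypersurfaces. -/

variable {n : ℕ}

/-- `R` is a holomorphic function on `ℂⁿ⁺¹ × ℂⁿ⁺¹` such that `{R = 0}` is the complexification of
the Levi-nondegenerate hypersurface `M`. -/
structure IsNondegComplexification (M : Set (CSpace n)) (R : CSpace n × CSpace n → ℂ) : Prop where
  analytic : AnalyticAt ℂ R 0
  map_zero : R 0 = 0
  mem_iff : ∀ᶠ x in 𝓝 (0 : CSpace n), x ∈ M ↔ R (x, star x) = 0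
  exists_fderiv_ne : ∃ v, fderiv ℂ R 0 (v, 0) ≠ 0
  vanish : ∀ H : CSpace n × CSpace n → ℂ, AnalyticAt ℂ H 0 →
    (∀ᶠ x in 𝓝 (0 : CSpace n), x ∈ M → H (x, star x) = 0) →
    (∀ᶠ y in 𝓝 (0 : CSpace n × CSpace n), R y = 0 → H y = 0) ∧
      ∀ u, fderiv ℂ R 0 u = 0 → fderiv ℂ H 0 u = 0
  nondeg : ∀ η, fderiv ℂ R 0 (0, η) = 0 →
    (∀ u, fderiv ℂ R 0 (u, 0) = 0 → fderiv ℂ (fderiv ℂ R) 0 (u, 0) (0, η) = 0) → η = 0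

section Levi

variable {r : CSpace n → ℝ}

theorem hess_symm (hr : AnalyticAt ℝ r 0) (u v : CSpace n) : hess r u v = hess r v u := by
  have : IsSymmSndFDerivAt ℝ r 0 :=
    (hr.contDiffAt (n := 2)).isSymmSndFDerivAt (by simp)
  exact this.eq u v

theorem leviForm_symm (hr : AnalyticAt ℝ r 0) (u v : CSpace n) :
    leviForm r v u = star (leviForm r u v) := by
  unfold leviForm
  rw [hess_symm hr v u, hess_symm hr v (Complex.I • u), hess_symm hr (Complex.I • v) u,
    hess_symm hr (Complex.I • v) (Complex.I • u)]
  simp only [star_mul', star_add, RCLike.star_def, Complex.conj_ofReal, Complex.conj_I]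
  simp only [map_div₀, map_one, Complex.conj_ofNat]
  push_cast
  ring

variable {R : CSpace n × CSpace n → ℂ}

/-- The values of `dR` at `(v, v̄)` and `(i v, -i v̄)` are known from `dr`; solving for the two
halves gives its holomorphic and antiholomorphic parts. -/
theorem fderiv_polarization_left (hR : AnalyticAt ℂ R 0) (hr : AnalyticAt ℝ r 0)
    (h : ∀ᶠ x in 𝓝 (0 : CSpace n), R (x, star x) = r x) (v : CSpace n) :
    fderiv ℂ R 0 (v, 0) =
      (1 / 2) * (fderiv ℝ r 0 v - Complex.I * fderiv ℝ r 0 (Complex.I • v)) ∧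
    fderiv ℂ R 0 (0, star v) =
      (1 / 2) * (fderiv ℝ r 0 v + Complex.I * fderiv ℝ r 0 (Complex.I • v)) := by
  have h1 := fderiv_polarization_zero hR hr.differentiableAt h v
  have h2 := fderiv_polarization_zero hR hr.differentiableAt h (Complex.I • v)
  have e1 : (v, star v) = (v, (0 : CSpace n)) + (0, star v) := by simp
  have e2 : (Complex.I • v, star (Complex.I • v)) =
      Complex.I • (v, (0 : CSpace n)) - Complex.I • (0, star v) := by
    rw [star_smul]; simp
  rw [e1, map_add] at h1
  rw [e2, map_sub, map_smul, map_smul, smul_eq_mul, smul_eq_mul] at h2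
  rw [← h1, ← h2]
  constructor <;> ring_nf <;> rw [Complex.I_sq] <;> ring

theorem isComplexTangent_iff_left (hR : AnalyticAt ℂ R 0) (hr : AnalyticAt ℝ r 0)
    (h : ∀ᶠ x in 𝓝 (0 : CSpace n), R (x, star x) = r x) (v : CSpace n) :
    IsComplexTangent r v ↔ fderiv ℂ R 0 (v, 0) = 0 := by
  rw [(fderiv_polarization_left hR hr h v).1, IsComplexTangent, Complex.ext_iff]
  simp

theorem isComplexTangent_iff_right (hR : AnalyticAt ℂ R 0) (hr : AnalyticAt ℝ r 0)
    (h : ∀ᶠ x in 𝓝 (0 : CSpace n), R (x, star x) = r x) (v : CSpace n) :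
    IsComplexTangent r v ↔ fderiv ℂ R 0 (0, star v) = 0 := by
  rw [(fderiv_polarization_left hR hr h v).2, IsComplexTangent, Complex.ext_iff]
  simp

/-- The Levi form is the mixed second derivative of the polarization. -/
theorem leviForm_eq (hR : AnalyticAt ℂ R 0) (hr : AnalyticAt ℝ r 0)
    (h : ∀ᶠ x in 𝓝 (0 : CSpace n), R (x, star x) = r x) (u v : CSpace n) :
    leviForm r u v = fderiv ℂ (fderiv ℂ R) 0 (u, 0) (0, star v) := by
  have key := fderiv_fderiv_polarization hR hr h
  set B := fderiv ℂ (fderiv ℂ R) 0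
  have e1 : ∀ v : CSpace n, (v, star v) = (v, (0 : CSpace n)) + (0, star v) := by simp
  have e2 : ∀ v : CSpace n, (Complex.I • v, star (Complex.I • v)) =
      Complex.I • (v, (0 : CSpace n)) - Complex.I • (0, star v) := by
    intro v; rw [star_smul]; simp
  -- In the Levi combination of these four values every block of `B` cancels except the one pairing
  -- `(u, 0)` with `(0, v̄)`, which appears four times.
  have k1 := key u v
  have k2 := key (Complex.I • u) (Complex.I • v)
  have k3 := key u (Complex.I • v)
  have k4 := key (Complex.I • u) v
  rw [e1, e1] at k1
  rw [e2, e2] at k2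
  rw [e1, e2] at k3
  rw [e2, e1] at k4
  simp only [map_add, map_sub, map_smul, _root_.add_apply, _root_.sub_apply,
    _root_.smul_apply, smul_eq_mul] at k1 k2 k3 k4
  unfold leviForm hess
  push_cast
  rw [← k1, ← k2, ← k3, ← k4]
  ring_nf
  rw [Complex.I_sq]
  ring

/-- Levi-nondegenerate real-analytic hypersurfaces have complexifications. -/
theorem IsLeviNondegenerateHypersurface.exists_complexification {M : Set (CSpace n)}
    (hM : IsLeviNondegenerateHypersurface M) : ∃ R, IsNondegComplexification M R := by
  obtain ⟨r, ⟨hr, hr0, hdr, hmem⟩, hnd⟩ := hM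
  obtain ⟨R, hR, hRr⟩ := exists_polarization hr
  have hR0 : R 0 = 0 := by
    have := hRr.self_of_nhds
    rw [hr0] at this
    simpa [Prod.mk_zero_zero] using this
  refine ⟨R, hR, hR0, ?_, ?_, ?_, ?_⟩
  · filter_upwards [hmem, hRr] with x h1 h2
    rw [h1, h2]; simp
  · by_contra hall
    push Not at hall
    apply hdr
    exact ContinuousLinearMap.ext fun v =>
      ((isComplexTangent_iff_left hR hr hRr v).2 (hall v)).1
  · intro H hH hz
    refine vanish_on_complexification hR hR0 hr.differentiableAt hRr hdr hH ?_
    filter_upwards [hz, hmem] with x h1 h2 h3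
    exact h1 (h2.2 h3)
  · intro η h1 h2
    have hη : star (star η) = η := star_star η
    rw [← hη] at h1
    have ht := (isComplexTangent_iff_right hR hr hRr (star η)).2 h1
    -- Nondegeneracy is given in the first argument of the Levi form but needed in the second;
    -- Hermitian symmetry exchanges them.
    have := hnd (star η) ht fun v hv => by
      rw [leviForm_symm hr v, leviForm_eq hR hr hRr, star_star,
        h2 v ((isComplexTangent_iff_left hR hr hRr v).1 hv), star_zero]
    simpa using this

/-- Levi-nondegeneracy is invariant under linear changes of coordinates. -/
theorem IsLeviNondegenerateHypersurface.image {M : Set (CSpace n)}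
    (hM : IsLeviNondegenerateHypersurface M) (L : CSpace n ≃L[ℂ] CSpace n) :
    IsLeviNondegenerateHypersurface (L '' M) := by
  obtain ⟨r, ⟨hr, hr0, hdr, hmem⟩, hnd⟩ := hM
  let A : CSpace n →L[ℝ] CSpace n := (L.symm : CSpace n →L[ℂ] CSpace n).restrictScalars ℝ
  have hA : ∀ x, A x = L.symm x := fun x => rfl
  have hAt : Filter.Tendsto A (𝓝 0) (𝓝 0) := by simpa using A.continuous.tendsto 0
  have hd : ∀ᶠ x in 𝓝 (0 : CSpace n), fderiv ℝ (fun y => r (A y)) x = (fderiv ℝ r (A x)).comp A := by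
    filter_upwards [hAt.eventually hr.eventually_analyticAt] with x hx
    exact (hx.differentiableAt.hasFDerivAt.comp x A.hasFDerivAt).fderiv
  have hd0 : ∀ v, fderiv ℝ (fun y => r (A y)) 0 v = fderiv ℝ r 0 (L.symm v) := by
    intro v
    rw [hd.self_of_nhds, map_zero]; rfl
  have hh : ∀ u v, hess (fun y => r (A y)) u v = hess r (L.symm u) (L.symm v) := by
    intro u v
    unfold hess
    rw [Filter.EventuallyEq.fderiv_eq hd]
    have h1 : HasFDerivAt (fun x => fderiv ℝ r (A x)) ((fderiv ℝ (fderiv ℝ r) 0).comp A) 0 := by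
      refine HasFDerivAt.comp (0 : CSpace n) ?_ A.hasFDerivAt
      rw [map_zero]
      exact hr.fderiv.differentiableAt.hasFDerivAt
    rw [(h1.clm_comp (hasFDerivAt_const A 0)).fderiv]
    simp [hA]
  have hl : ∀ u v, leviForm (fun y => r (A y)) u v = leviForm r (L.symm u) (L.symm v) := by
    intro u v
    simp only [leviForm, hh, map_smul]
  have ht : ∀ v, IsComplexTangent (fun y => r (A y)) v ↔ IsComplexTangent r (L.symm v) := by
    intro v
    simp only [IsComplexTangent, hd0, map_smul]
  refine ⟨fun y => r (A y), ⟨?_, ?_, ?_, ?_⟩, ?_⟩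
  · exact AnalyticAt.comp (by simpa using hr) (A.analyticAt 0)
  · simpa using hr0
  · intro h0
    apply hdr
    refine ContinuousLinearMap.ext fun v => ?_
    have := hd0 (L v)
    rw [h0] at this
    simpa using this.symm
  · filter_upwards [hAt.eventually hmem] with x hx
    rw [← hx, hA]
    constructor
    · rintro ⟨y, hy, rfl⟩; simpa using hy
    · intro h; exact ⟨_, h, by simp⟩
  · intro u hu h
    have := hnd (L.symm u) ((ht u).1 hu) fun v hv => by
      have h2 := h (L v) ((ht _).2 (by simpa using hv))
      rw [hl] at h2
      simpa using h2
    simpa using this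

end Levi

/-! ### The Segre family and its jet map. -/

theorem analyticAt_dz {ρ : (Fin n → ℂ) × (Fin n → ℂ) × ℂ → ℂ} {q : (Fin n → ℂ) × (Fin n → ℂ) × ℂ}
    (hρ : AnalyticAt ℂ ρ q) (j : Fin n) : AnalyticAt ℂ (dz j ρ) q :=
  ((ContinuousLinearMap.apply ℂ ℂ
    ((Pi.single j 1, 0, 0) : (Fin n → ℂ) × (Fin n → ℂ) × ℂ)).analyticAt _).comp hρ.fderiv

/-- The map `(z, ζ, ω) ↦ (z, ρ)`. -/
def segreGraph (ρ : (Fin n → ℂ) × (Fin n → ℂ) × ℂ → ℂ) (q : (Fin n → ℂ) × (Fin n → ℂ) × ℂ) :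
    CSpace n := (q.1, ρ q)

/-- The map `(z, ζ, ω) ↦ (z, ρ, ρ_z)` to the space of `1`-jets. -/
def segreJet (ρ : (Fin n → ℂ) × (Fin n → ℂ) × ℂ → ℂ) (q : (Fin n → ℂ) × (Fin n → ℂ) × ℂ) :
    CSpace n × (Fin n → ℂ) := (segreGraph ρ q, fun j => dz j ρ q)

theorem analyticAt_segreGraph {ρ : (Fin n → ℂ) × (Fin n → ℂ) × ℂ → ℂ}
    {q : (Fin n → ℂ) × (Fin n → ℂ) × ℂ} (hρ : AnalyticAt ℂ ρ q) :
    AnalyticAt ℂ (segreGraph ρ) q := analyticAt_fst.prod hρ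

theorem analyticAt_segreJet {ρ : (Fin n → ℂ) × (Fin n → ℂ) × ℂ → ℂ}
    {q : (Fin n → ℂ) × (Fin n → ℂ) × ℂ} (hρ : AnalyticAt ℂ ρ q) :
    AnalyticAt ℂ (segreJet ρ) q :=
  (analyticAt_segreGraph hρ).prod (analyticAt_pi_iff.2 fun j => analyticAt_dz hρ j)

section

variable {M : Set (CSpace n)} {R : CSpace n × CSpace n → ℂ}
  {ρ : (Fin n → ℂ) × (Fin n → ℂ) × ℂ → ℂ}

/-- The point of the complexification of `M` with parameters `(z, ζ, ω)`. -/
def segreLift (ρ : (Fin n → ℂ) × (Fin n → ℂ) × ℂ → ℂ) (q : (Fin n → ℂ) × (Fin n → ℂ) × ℂ) :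
    CSpace n × CSpace n := (segreGraph ρ q, q.2)

theorem IsComplexDefiningFunction.map_zero (hR : IsNondegComplexification M R)
    (hρ : IsComplexDefiningFunction M ρ) : ρ 0 = 0 := by
  have h1 := hR.mem_iff.self_of_nhds
  have h2 := hρ.2.self_of_nhds
  rw [h1] at h2
  have := h2.1 (by simpa [Prod.mk_zero_zero] using hR.map_zero)
  simpa [Prod.mk_zero_zero] using this.symm

/-- The function `w - ρ` vanishes on `M`, so its differential vanishes wherever `dR` does; but it
equals `1` on the `w`-direction. -/
theorem IsNondegComplexification.fderiv_w_ne (hR : IsNondegComplexification M R)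
    (hρ : IsComplexDefiningFunction M ρ) : fderiv ℂ R 0 ((0, 1), 0) ≠ 0 := by
  let s : CSpace n × CSpace n →L[ℂ] (Fin n → ℂ) × CSpace n :=
    ((ContinuousLinearMap.fst ℂ (Fin n → ℂ) ℂ).comp (ContinuousLinearMap.fst ℂ _ _)).prod
      (ContinuousLinearMap.snd ℂ _ _)
  let t : CSpace n × CSpace n →L[ℂ] ℂ :=
    (ContinuousLinearMap.snd ℂ (Fin n → ℂ) ℂ).comp (ContinuousLinearMap.fst ℂ _ _)
  have hρs : AnalyticAt ℂ ρ (s 0) := by rw [_root_.map_zero]; exact hρ.1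
  have hH : AnalyticAt ℂ (fun y => t y - ρ (s y)) 0 :=
    (t.analyticAt 0).sub (hρs.comp (s.analyticAt 0))
  obtain ⟨-, h2⟩ := hR.vanish _ hH (by
    filter_upwards [hρ.2] with x hx hxM
    exact sub_eq_zero.2 (hx.1 hxM))
  intro h0
  have h3 := h2 _ h0
  have h4 : HasFDerivAt (fun y => t y - ρ (s y)) (t - (fderiv ℂ ρ (s 0)).comp s) 0 :=
    t.hasFDerivAt.sub (hρs.differentiableAt.hasFDerivAt.comp _ s.hasFDerivAt)
  rw [h4.fderiv] at h3
  have h5 : s ((0, 1), 0) = 0 := rfl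
  have h6 : t ((0, 1), 0) = 1 := rfl
  simp [h5, h6] at h3

/-- Solving `R = 0` for `w`. -/
theorem IsNondegComplexification.exists_implicit (hR : IsNondegComplexification M R)
    (hw : fderiv ℂ R 0 ((0, 1), 0) ≠ 0) :
    ∃ ρ : (Fin n → ℂ) × (Fin n → ℂ) × ℂ → ℂ, AnalyticAt ℂ ρ 0 ∧
      ∀ᶠ y in 𝓝 (0 : CSpace n × CSpace n), R y = 0 ↔ y.1.2 = ρ (y.1.1, y.2) := by
  let s : ℂ × ((Fin n → ℂ) × CSpace n) →L[ℂ] CSpace n × CSpace n :=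
    (((ContinuousLinearMap.fst ℂ _ _).comp (ContinuousLinearMap.snd ℂ _ _)).prod
      (ContinuousLinearMap.fst ℂ _ _)).prod
      ((ContinuousLinearMap.snd ℂ _ _).comp (ContinuousLinearMap.snd ℂ _ _))
  have hRs : AnalyticAt ℂ R (s 0) := by rw [_root_.map_zero]; exact hR.analytic
  obtain ⟨ρ, hρ, h⟩ := JetTr.exists_implicit (R := fun p => R (s p)) (hRs.comp (s.analyticAt 0))
    (by simpa using hR.map_zero) (by
      have h1 : HasFDerivAt (fun p => R (s p)) ((fderiv ℂ R (s 0)).comp s) 0 :=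
        hRs.differentiableAt.hasFDerivAt.comp _ s.hasFDerivAt
      rw [h1.fderiv, _root_.map_zero]
      exact hw)
  refine ⟨ρ, hρ, ?_⟩
  have ht : Filter.Tendsto
      (fun y : CSpace n × CSpace n => (y.1.2, ((y.1.1, y.2) : (Fin n → ℂ) × CSpace n)))
      (𝓝 0) (𝓝 0) := by
    have : ContinuousAt
      (fun y : CSpace n × CSpace n => (y.1.2, ((y.1.1, y.2) : (Fin n → ℂ) × CSpace n))) 0 := by
      fun_prop
    exact this.tendsto
  exact ht.eventually h

theorem tendsto_segreLift (hρ : AnalyticAt ℂ ρ 0) (h0 : ρ 0 = 0) :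
    Filter.Tendsto (segreLift ρ) (𝓝 0) (𝓝 0) := by
  have : ContinuousAt (segreLift ρ) 0 :=
    (analyticAt_segreGraph hρ).continuousAt.prodMk continuousAt_snd
  have h := this.tendsto
  have h2 : segreLift ρ 0 = 0 := by
    simp [segreLift, segreGraph, h0, Prod.mk_zero_zero]
  rwa [h2] at h

/-- Solving `R = 0` for `w` gives some graph `ρ₀`. As `w - ρ` vanishes on `M`, it vanishes on `{R =
0}`, which forces `ρ₀ = ρ`. -/
theorem IsNondegComplexification.map_segreLift (hR : IsNondegComplexification M R)
    (hρ : IsComplexDefiningFunction M ρ) :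
    ∀ᶠ q in 𝓝 (0 : (Fin n → ℂ) × (Fin n → ℂ) × ℂ), R (segreLift ρ q) = 0 := by
  have hρ0 := hρ.map_zero hR
  obtain ⟨ρ₀, ha, h⟩ := hR.exists_implicit (hR.fderiv_w_ne hρ)
  have h00 : ρ₀ 0 = 0 := by
    have := h.self_of_nhds.1 hR.map_zero
    exact this.symm
  let s : CSpace n × CSpace n →L[ℂ] (Fin n → ℂ) × CSpace n :=
    ((ContinuousLinearMap.fst ℂ (Fin n → ℂ) ℂ).comp (ContinuousLinearMap.fst ℂ _ _)).prod
      (ContinuousLinearMap.snd ℂ _ _)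
  have hH : AnalyticAt ℂ (fun y : CSpace n × CSpace n => y.1.2 - ρ (s y)) 0 :=
    ((analyticAt_snd).comp analyticAt_fst).sub
      (AnalyticAt.comp (by rw [_root_.map_zero]; exact hρ.1) (s.analyticAt 0))
  obtain ⟨h1, -⟩ := hR.vanish _ hH (by
    filter_upwards [hρ.2] with x hx hxM
    exact sub_eq_zero.2 (hx.1 hxM))
  have ht := tendsto_segreLift ha h00
  filter_upwards [ht.eventually h, ht.eventually h1] with q e1 e2
  have e3 : R (segreLift ρ₀ q) = 0 := e1.2 rfl
  have e4 : ρ₀ q = ρ q := sub_eq_zero.1 (e2 e3)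
  rw [← e3]
  simp only [segreLift, segreGraph, e4]

/-- Identity principle on the complexification. -/
theorem IsNondegComplexification.identity (hR : IsNondegComplexification M R)
    (hρ : IsComplexDefiningFunction M ρ) {h : (Fin n → ℂ) × (Fin n → ℂ) × ℂ → ℂ}
    (hh : AnalyticAt ℂ h 0) (hz : ∀ᶠ x in 𝓝 (0 : CSpace n), x ∈ M → h (x.1, star x) = 0) :
    ∀ᶠ q in 𝓝 (0 : (Fin n → ℂ) × (Fin n → ℂ) × ℂ), h q = 0 := by
  let s : CSpace n × CSpace n →L[ℂ] (Fin n → ℂ) × CSpace n :=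
    ((ContinuousLinearMap.fst ℂ (Fin n → ℂ) ℂ).comp (ContinuousLinearMap.fst ℂ _ _)).prod
      (ContinuousLinearMap.snd ℂ _ _)
  obtain ⟨h1, -⟩ := hR.vanish (fun y => h (s y))
    (AnalyticAt.comp (by rw [_root_.map_zero]; exact hh) (s.analyticAt 0)) hz
  filter_upwards [(tendsto_segreLift hρ.1 (hρ.map_zero hR)).eventually h1,
    hR.map_segreLift hρ] with q e1 e2
  exact e1 e2

theorem hasFDerivAt_segreGraph {q : (Fin n → ℂ) × (Fin n → ℂ) × ℂ} (hρ : AnalyticAt ℂ ρ q) :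
    HasFDerivAt (segreGraph ρ) ((ContinuousLinearMap.fst ℂ _ _).prod (fderiv ℂ ρ q)) q :=
  hasFDerivAt_fst.prodMk hρ.differentiableAt.hasFDerivAt

theorem hasFDerivAt_segreLift {q : (Fin n → ℂ) × (Fin n → ℂ) × ℂ} (hρ : AnalyticAt ℂ ρ q) :
    HasFDerivAt (segreLift ρ) (((ContinuousLinearMap.fst ℂ _ _).prod (fderiv ℂ ρ q)).prod
      (ContinuousLinearMap.snd ℂ _ _)) q :=
  (hasFDerivAt_segreGraph hρ).prodMk hasFDerivAt_snd

/-- The differential of the jet map of the Segre family is injective. -/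
theorem IsNondegComplexification.ker_fderiv_segreJet (hR : IsNondegComplexification M R)
    (hρ : IsComplexDefiningFunction M ρ) (b : CSpace n) (hb : fderiv ℂ ρ 0 (0, b) = 0)
    (hb' : ∀ j, fderiv ℂ (dz j ρ) 0 (0, b) = 0) : b = 0 := by
  have hρ0 := hρ.map_zero hR
  have hl0 : segreLift ρ 0 = 0 := by simp [segreLift, segreGraph, hρ0, Prod.mk_zero_zero]
  have ht := tendsto_segreLift hρ.1 hρ0
  have hz := hR.map_segreLift hρ
  have hD : ∀ᶠ q in 𝓝 (0 : (Fin n → ℂ) × (Fin n → ℂ) × ℂ), ∀ v,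
      fderiv ℂ R (segreLift ρ q) ((v.1, fderiv ℂ ρ q v), v.2) = 0 := by
    filter_upwards [hz.eventually_nhds, hρ.1.eventually_analyticAt,
      ht.eventually hR.analytic.eventually_analyticAt] with q h1 h2 h3 v
    have := (h3.differentiableAt.hasFDerivAt.comp q (hasFDerivAt_segreLift h2)).unique
      ((hasFDerivAt_const (0 : ℂ) q).congr_of_eventuallyEq h1)
    exact congrArg (fun A => A v) this
  have hD0 : ∀ v, fderiv ℂ R 0 ((v.1, fderiv ℂ ρ 0 v), v.2) = 0 := by
    have := hD.self_of_nhds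
    rwa [hl0] at this
  refine hR.nondeg b ?_ ?_
  · have := hD0 (0, b)
    rw [hb] at this
    exact this
  · intro u hu
    have hu2 : u.2 = fderiv ℂ ρ 0 (u.1, 0) := by
      have h1 := hD0 (u.1, 0)
      have h2 : fderiv ℂ R 0 ((u.2 - fderiv ℂ ρ 0 (u.1, 0)) • ((0, 1), 0)) = 0 := by
        have e : (u.2 - fderiv ℂ ρ 0 (u.1, 0)) • (((0, 1), 0) : CSpace n × CSpace n) =
            (u, 0) - ((u.1, fderiv ℂ ρ 0 (u.1, 0)), 0) := by
          ext <;> simp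
        rw [e, map_sub, hu, h1, sub_zero]
      rw [map_smul, smul_eq_mul] at h2
      exact sub_eq_zero.1 ((mul_eq_zero.1 h2).resolve_right (hR.fderiv_w_ne hρ))
    -- The relation `dR (e_j, ρ_{z_j}, 0) = 0` along the Segre family is differentiated in direction
    -- `(0, b)`. As `ρ` and `ρ_{z_j}` are stationary in that direction, only the mixed second
    -- derivative of `R` remains.
    have hj : ∀ j, fderiv ℂ (fderiv ℂ R) 0 (0, b)
        ((Pi.single j 1, dz j ρ 0), 0) = 0 := by
      intro j
      have h1 : ∀ᶠ q in 𝓝 (0 : (Fin n → ℂ) × (Fin n → ℂ) × ℂ),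
          fderiv ℂ R (segreLift ρ q) ((Pi.single j 1, dz j ρ q), 0) = 0 := by
        filter_upwards [hD] with q hq
        exact hq (Pi.single j 1, 0)
      have h2 : HasFDerivAt (fun q => fderiv ℂ R (segreLift ρ q)) _ 0 :=
        HasFDerivAt.comp (0 : (Fin n → ℂ) × (Fin n → ℂ) × ℂ)
          (by rw [hl0]; exact hR.analytic.fderiv.differentiableAt.hasFDerivAt)
          (hasFDerivAt_segreLift hρ.1)
      have h3 : HasFDerivAt (fun q => (((Pi.single j 1, dz j ρ q), 0) : CSpace n × CSpace n)) _ 0 :=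
        ((hasFDerivAt_const (Pi.single j (1 : ℂ) : Fin n → ℂ) _).prodMk
          (analyticAt_dz hρ.1 j).differentiableAt.hasFDerivAt).prodMk
          (hasFDerivAt_const (0 : CSpace n) _)
      have h4 := (h2.clm_apply h3).unique
        ((hasFDerivAt_const (0 : ℂ) _).congr_of_eventuallyEq h1)
      have h5 := congrArg (fun A => A (0, b)) h4
      simp only [_root_.add_apply, ContinuousLinearMap.comp_apply,
        ContinuousLinearMap.flip_apply, ContinuousLinearMap.prod_apply,
        ContinuousLinearMap.coe_fst', ContinuousLinearMap.coe_snd', hb, hb' j,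
        _root_.zero_apply] at h5
      have h6 : ((0 : Fin n → ℂ), (0 : ℂ)) = 0 := rfl
      have h7 : ((0 : CSpace n), (0 : CSpace n)) = 0 := rfl
      rw [h6, h7, _root_.map_zero, zero_add] at h5
      exact h5
    have hsym : IsSymmSndFDerivAt ℂ R 0 :=
      (hR.analytic.contDiffAt (n := 2)).isSymmSndFDerivAt (by simp)
    rw [hsym.eq]
    -- The vectors `(e_j, ρ_{z_j})` span the complex tangent space.
    have hdec : ((u, 0) : CSpace n × CSpace n) =
        ∑ j, u.1 j • (((Pi.single j 1, dz j ρ 0), 0) : CSpace n × CSpace n) := by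
      have hu1 : u.1 = ∑ j, u.1 j • (Pi.single j 1 : Fin n → ℂ) := by
        ext i; simp [Finset.sum_apply, Pi.single_apply]
      refine Prod.ext (Prod.ext ?_ ?_) ?_
      · rw [Prod.fst_sum, Prod.fst_sum]; exact hu1
      · rw [Prod.fst_sum, Prod.snd_sum]
        change u.2 = _
        have : ((u.1, 0) : (Fin n → ℂ) × CSpace n) =
            ∑ j, u.1 j • ((Pi.single j 1, 0) : (Fin n → ℂ) × CSpace n) := by
          refine Prod.ext ?_ ?_
          · rw [Prod.fst_sum]; exact hu1
          · rw [Prod.snd_sum]; simp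
        rw [hu2, this, map_sum]
        refine Finset.sum_congr rfl fun j _ => ?_
        rw [map_smul]; rfl
      · rw [Prod.snd_sum]; simp
    rw [hdec, map_sum]
    refine Finset.sum_eq_zero fun j _ => ?_
    rw [map_smul, hj, smul_zero]

/-- The jet map of the Segre family is a local biholomorphism. -/
theorem IsNondegComplexification.exists_isBiholoGerm_segreJet (hR : IsNondegComplexification M R)
    (hρ : IsComplexDefiningFunction M ρ) :
    ∃ κ, IsBiholoGerm 0 ((0 : CSpace n), fun j => dz j ρ 0) (segreJet ρ) κ := by
  have hρ0 := hρ.map_zero hR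
  have hd : HasFDerivAt (segreJet ρ) (((ContinuousLinearMap.fst ℂ _ _).prod (fderiv ℂ ρ 0)).prod
      (ContinuousLinearMap.pi fun j => fderiv ℂ (dz j ρ) 0)) 0 :=
    (hasFDerivAt_segreGraph hρ.1).prodMk
      (hasFDerivAt_pi.2 fun j => (analyticAt_dz hρ.1 j).differentiableAt.hasFDerivAt)
  set D := ((ContinuousLinearMap.fst ℂ (Fin n → ℂ) ((Fin n → ℂ) × ℂ)).prod (fderiv ℂ ρ 0)).prod
      (ContinuousLinearMap.pi fun j => fderiv ℂ (dz j ρ) 0) with hDdef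
  have hinj : Function.Injective D := by
    rw [injective_iff_map_eq_zero]
    rintro ⟨a, b⟩ h
    have ha : a = 0 := congrArg (fun t => t.1.1) h
    subst ha
    have hb := hR.ker_fderiv_segreJet hρ b (congrArg (fun t => t.1.2) h)
      fun j => congrFun (congrArg Prod.snd h) j
    subst hb
    rfl
  -- Source and target both have dimension `2 n + 1`, so injectivity of the differential suffices.
  have hfin : Module.finrank ℂ ((Fin n → ℂ) × (Fin n → ℂ) × ℂ) =
      Module.finrank ℂ (CSpace n × (Fin n → ℂ)) := by
    simp only [Module.finrank_prod]; ring
  let e := (LinearEquiv.ofInjectiveOfFinrankEq D.toLinearMap hinj hfin).toContinuousLinearEquiv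
  obtain ⟨κ, hκ⟩ := exists_isBiholoGerm (analyticAt_segreJet hρ.1) e (by
    rw [hd.fderiv]; rfl)
  refine ⟨κ, ?_⟩
  have h0 : segreJet ρ 0 = ((0 : CSpace n), fun j => dz j ρ 0) := by
    simp [segreJet, segreGraph, hρ0, Prod.mk_zero_zero]
  rwa [h0] at hκ

end

/-- Existence of linear coordinates with a complex defining function. -/
theorem IsLeviNondegenerateHypersurface.exists_isComplexDefiningFunction {M : Set (CSpace n)}
    (hM : IsLeviNondegenerateHypersurface M) :
    ∃ (L : CSpace n ≃L[ℂ] CSpace n) (ρ : (Fin n → ℂ) × (Fin n → ℂ) × ℂ → ℂ),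
      IsComplexDefiningFunction (L '' M) ρ := by
  obtain ⟨R, hR⟩ := hM.exists_complexification
  obtain ⟨v, hv⟩ := hR.exists_fderiv_ne
  have hv0 : v ≠ 0 := by
    rintro rfl
    exact hv (by rw [Prod.mk_zero_zero, map_zero])
  -- The coordinates are chosen so that the complex-transversal vector `v` becomes the
  -- `w`-direction.
  obtain ⟨L, hL⟩ := SeparatingDual.exists_continuousLinearEquiv_apply_eq (R := ℂ) hv0
    (y := ((0, 1) : CSpace n)) (by simp)
  obtain ⟨R', hR'⟩ := (hM.image L).exists_complexification
  have hw : fderiv ℂ R' 0 ((0, 1), 0) ≠ 0 := by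
    -- `R'` is unrelated to `R` by construction. The comparison uses that `R ∘ (L⁻¹ × B)`, with `B`
    -- the conjugate of `L⁻¹`, vanishes on `L '' M`: if `dR'` killed the `w`-direction, `dR` would
    -- kill `(v, 0)`.
    let B : CSpace n →ₗ[ℂ] CSpace n :=
      { toFun := fun ξ => star (L.symm (star ξ))
        map_add' := fun x y => by simp
        map_smul' := fun c x => by simp [star_smul] }
    let s : CSpace n × CSpace n →L[ℂ] CSpace n × CSpace n :=
      (L.symm : CSpace n →L[ℂ] CSpace n).prodMap (LinearMap.toContinuousLinearMap B)
    have hs : ∀ y, s y = (L.symm y.1, star (L.symm (star y.2))) := fun y => rfl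
    have hRs : AnalyticAt ℂ R (s 0) := by rw [map_zero]; exact hR.analytic
    obtain ⟨-, h2⟩ := hR'.vanish (fun y => R (s y)) (hRs.comp (s.analyticAt 0)) (by
      have ht : Filter.Tendsto L.symm (𝓝 0) (𝓝 0) := by
        simpa using L.symm.continuous.tendsto 0
      filter_upwards [ht.eventually hR.mem_iff] with x hx hxM
      obtain ⟨y, hy, rfl⟩ := hxM
      rw [hs, star_star]
      exact hx.1 (by simpa using hy))
    intro h0
    have h3 := h2 _ h0
    have h4 : HasFDerivAt (fun y => R (s y)) ((fderiv ℂ R (s 0)).comp s) 0 :=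
      hRs.differentiableAt.hasFDerivAt.comp _ s.hasFDerivAt
    rw [h4.fderiv, ContinuousLinearMap.comp_apply, map_zero, hs, ← hL] at h3
    apply hv
    simpa using h3
  obtain ⟨ρ, hρ, h⟩ := hR'.exists_implicit hw
  refine ⟨L, ρ, hρ, ?_⟩
  filter_upwards [hR'.mem_iff, tendsto_conjDiag.eventually h] with x h1 h2
  rw [h1, h2]
  rfl

/-! ### The degree as that of an extension of fields on the complexification. -/

section SegreField

/-- The field of meromorphic germs generated by the functions of `(z, ρ)` and by `ρ_z`. -/
def segreField (ρ : (Fin n → ℂ) × (Fin n → ℂ) × ℂ → ℂ) :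
    Subfield (MeroGerms (0 : (Fin n → ℂ) × (Fin n → ℂ) × ℂ)) :=
  Subfield.closure
    ({g | ∃ (a : CSpace n → ℂ) (h : AnalyticAt ℂ (fun q => a (segreGraph ρ q)) 0),
        AnalyticAt ℂ a 0 ∧ g = toMero _ h} ∪
      {g | ∃ (j : Fin n) (h : AnalyticAt ℂ (dz j ρ) 0), g = toMero _ h})

/-- The extension of `segreField ρ` generated by the second derivatives `ρ_zz`. -/
def segreFieldExt (ρ : (Fin n → ℂ) × (Fin n → ℂ) × ℂ → ℂ) :
    Subfield (MeroGerms (0 : (Fin n → ℂ) × (Fin n → ℂ) × ℂ)) :=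
  Subfield.closure (segreField ρ ∪
    {g | ∃ (k l : Fin n) (h : AnalyticAt ℂ (dz k (dz l ρ)) 0), g = toMero _ h})

variable {ρ : (Fin n → ℂ) × (Fin n → ℂ) × ℂ → ℂ}

theorem segreField_le_segreFieldExt : segreField ρ ≤ segreFieldExt ρ :=
  fun _ hx => Subfield.subset_closure (Or.inl hx)

theorem analyticAt_comp_segreGraph (hρ : AnalyticAt ℂ ρ 0) (h0 : ρ 0 = 0) {E : Type*}
    [NormedAddCommGroup E] [NormedSpace ℂ E] {a : CSpace n → E} (ha : AnalyticAt ℂ a 0) :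
    AnalyticAt ℂ (fun q => a (segreGraph ρ q)) 0 := by
  have hg : segreGraph ρ 0 = 0 := by simp [segreGraph, h0, Prod.mk_zero_zero]
  exact AnalyticAt.comp (by rwa [hg]) (analyticAt_segreGraph hρ)

theorem tendsto_segreGraph (hρ : AnalyticAt ℂ ρ 0) (h0 : ρ 0 = 0) :
    Filter.Tendsto (segreGraph ρ) (𝓝 0) (𝓝 0) := by
  have hg : segreGraph ρ 0 = 0 := by simp [segreGraph, h0, Prod.mk_zero_zero]
  have := (analyticAt_segreGraph hρ).continuousAt.tendsto
  rwa [hg] at this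

theorem germIn_comp_segreGraph (hρ : AnalyticAt ℂ ρ 0) (h0 : ρ 0 = 0) {a : CSpace n → ℂ}
    (ha : AnalyticAt ℂ a 0) : GermIn (segreField ρ) (fun q => a (segreGraph ρ q)) :=
  ⟨analyticAt_comp_segreGraph hρ h0 ha,
    Subfield.subset_closure (Or.inl ⟨a, analyticAt_comp_segreGraph hρ h0 ha, ha, rfl⟩)⟩

theorem germIn_dz (hρ : AnalyticAt ℂ ρ 0) (j : Fin n) : GermIn (segreField ρ) (dz j ρ) :=
  ⟨analyticAt_dz hρ j, Subfield.subset_closure (Or.inr ⟨j, analyticAt_dz hρ j, rfl⟩)⟩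

theorem germIn_dz_dz (hρ : AnalyticAt ℂ ρ 0) (k l : Fin n) :
    GermIn (segreFieldExt ρ) (dz k (dz l ρ)) :=
  ⟨analyticAt_dz (analyticAt_dz hρ l) k,
    Subfield.subset_closure (Or.inr ⟨k, l, analyticAt_dz (analyticAt_dz hρ l) k, rfl⟩)⟩

theorem dz_congr {f g : (Fin n → ℂ) × (Fin n → ℂ) × ℂ → ℂ}
    {q : (Fin n → ℂ) × (Fin n → ℂ) × ℂ} (h : f =ᶠ[𝓝 q] g) (j : Fin n) :
    dz j f =ᶠ[𝓝 q] dz j g := by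
  filter_upwards [h.eventually_nhds] with x hx
  simp only [dz, Filter.EventuallyEq.fderiv_eq hx]

theorem dz_mul {f g : (Fin n → ℂ) × (Fin n → ℂ) × ℂ → ℂ} {q : (Fin n → ℂ) × (Fin n → ℂ) × ℂ}
    (hf : AnalyticAt ℂ f q) (hg : AnalyticAt ℂ g q) (j : Fin n) :
    dz j (fun x => f x * g x) q = dz j f q * g q + f q * dz j g q := by
  simp only [dz]
  rw [fderiv_fun_mul hf.differentiableAt hg.differentiableAt]
  simp only [_root_.add_apply, _root_.smul_apply, smul_eq_mul]
  ring

theorem dz_add {f g : (Fin n → ℂ) × (Fin n → ℂ) × ℂ → ℂ} {q : (Fin n → ℂ) × (Fin n → ℂ) × ℂ}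
    (hf : AnalyticAt ℂ f q) (hg : AnalyticAt ℂ g q) (j : Fin n) :
    dz j (fun x => f x + g x) q = dz j f q + dz j g q := by
  simp only [dz]
  rw [fderiv_fun_add hf.differentiableAt hg.differentiableAt]
  rfl

theorem dz_sum {ι : Type*} (s : Finset ι) {F : ι → (Fin n → ℂ) × (Fin n → ℂ) × ℂ → ℂ}
    {q : (Fin n → ℂ) × (Fin n → ℂ) × ℂ} (hF : ∀ i, AnalyticAt ℂ (F i) q) (j : Fin n) :
    dz j (fun x => ∑ i ∈ s, F i x) q = ∑ i ∈ s, dz j (F i) q := by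
  simp only [dz]
  rw [fderiv_fun_sum fun i _ => (hF i).differentiableAt]
  simp

/-- Chain rule for functions of `(z, ρ)`. -/
theorem dz_comp_segreGraph (hρ : AnalyticAt ℂ ρ 0) (h0 : ρ 0 = 0) {a : CSpace n → ℂ}
    (ha : AnalyticAt ℂ a 0) (l : Fin n) :
    dz l (fun q => a (segreGraph ρ q)) =ᶠ[𝓝 0] fun q =>
      fderiv ℂ a (segreGraph ρ q) (Pi.single l 1, 0) +
        fderiv ℂ a (segreGraph ρ q) (0, 1) * dz l ρ q := by
  filter_upwards [hρ.eventually_analyticAt,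
    (tendsto_segreGraph hρ h0).eventually ha.eventually_analyticAt] with q h1 h2
  have h3 : HasFDerivAt (fun q => a (segreGraph ρ q)) _ q :=
    h2.differentiableAt.hasFDerivAt.comp q (hasFDerivAt_segreGraph h1)
  simp only [dz]
  rw [h3.fderiv]
  have : ((Pi.single l 1, fderiv ℂ ρ q (Pi.single l 1, 0, 0)) : CSpace n) =
      (Pi.single l 1, 0) + (fderiv ℂ ρ q (Pi.single l 1, 0, 0)) • ((0, 1) : CSpace n) := by
    ext <;> simp
  change fderiv ℂ a (segreGraph ρ q) (Pi.single l 1, fderiv ℂ ρ q (Pi.single l 1, 0, 0)) = _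
  rw [this, map_add, map_smul, smul_eq_mul]
  ring

theorem analyticAt_fderiv_apply {V : Type*} [NormedAddCommGroup V] [NormedSpace ℂ V] {x : V}
    {a : V → ℂ} (ha : AnalyticAt ℂ a x) (v : V) : AnalyticAt ℂ (fun y => fderiv ℂ a y v) x :=
  ((ContinuousLinearMap.apply ℂ ℂ v).analyticAt _).comp ha.fderiv

theorem germIn_dz_comp_segreGraph (hρ : AnalyticAt ℂ ρ 0) (h0 : ρ 0 = 0) {a : CSpace n → ℂ}
    (ha : AnalyticAt ℂ a 0) (l : Fin n) :
    GermIn (segreField ρ) (dz l fun q => a (segreGraph ρ q)) :=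
  ((germIn_comp_segreGraph hρ h0 (analyticAt_fderiv_apply ha _)).add
    ((germIn_comp_segreGraph hρ h0 (analyticAt_fderiv_apply ha _)).mul
      (germIn_dz hρ l))).congr (dz_comp_segreGraph hρ h0 ha l).symm

/-- Differentiating `a_{z_l} + a_w ρ_{z_l}` by the product rule, the only term outside `segreField
ρ` is `a_w ρ_{z_m z_l}`. -/
theorem germIn_dz_dz_comp_segreGraph (hρ : AnalyticAt ℂ ρ 0) (h0 : ρ 0 = 0) {a : CSpace n → ℂ}
    (ha : AnalyticAt ℂ a 0) (m l : Fin n) :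
    GermIn (segreFieldExt ρ) (dz m (dz l fun q => a (segreGraph ρ q))) := by
  have ha1 := analyticAt_fderiv_apply ha (Pi.single l 1, 0)
  have ha2 := analyticAt_fderiv_apply ha (0, 1)
  have hle := segreField_le_segreFieldExt (ρ := ρ)
  have hb1 := analyticAt_comp_segreGraph hρ h0 ha1
  have hb2 := analyticAt_comp_segreGraph hρ h0 ha2
  have h := ((germIn_dz_comp_segreGraph hρ h0 ha1 m).mono hle).add
    ((((germIn_dz_comp_segreGraph hρ h0 ha2 m).mono hle).mul ((germIn_dz hρ l).mono hle)).add
      (((germIn_comp_segreGraph hρ h0 ha2).mono hle).mul (germIn_dz_dz hρ m l)))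
  refine h.congr (Filter.EventuallyEq.trans ?_
    (dz_congr (dz_comp_segreGraph hρ h0 ha l) m).symm)
  filter_upwards [hb1.eventually_analyticAt, hb2.eventually_analyticAt,
    hρ.eventually_analyticAt] with q h1 h2 h3
  rw [dz_add h1 (h2.fun_mul (analyticAt_dz h3 l)), dz_mul h2 (analyticAt_dz h3 l)]

/-- The base field of the jet space becomes the Segre field on the complexification. -/
theorem map_baseField (hρ : AnalyticAt ℂ ρ 0) (h0 : ρ 0 = 0) {p : Fin n → ℂ}
    {κ : CSpace n × (Fin n → ℂ) → (Fin n → ℂ) × (Fin n → ℂ) × ℂ}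
    (h : IsBiholoGerm 0 ((0 : CSpace n), p) (segreJet ρ) κ) :
    (baseField (0 : CSpace n) p).map h.pull = segreField ρ := by
  unfold baseField
  rw [RingHom.map_field_closure]
  apply le_antisymm
  · rw [Subfield.closure_le]
    rintro _ ⟨_, ⟨P, hP, ⟨s, a, ha, hPa⟩, rfl⟩, rfl⟩
    rw [h.pull_toMero]
    have : GermIn (segreField ρ) (P ∘ segreJet ρ) := by
      have e : P ∘ segreJet ρ =
          fun q => ∑ α ∈ s, a α (segreGraph ρ q) * ∏ i, dz i ρ q ^ α i := by
        ext q; exact hPa _ _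
      rw [e]
      exact GermIn.sum s fun α hα => (germIn_comp_segreGraph hρ h0 (ha α hα)).mul
        (GermIn.prod _ fun i _ => (germIn_dz hρ i).pow _)
    exact this.2
  · unfold segreField
    -- Every generator is already the pull-back of a polynomial: one of degree zero in `w'`, or a
    -- coordinate of `w'`.
    refine Subfield.closure_mono ?_
    rintro _ (⟨a, h1, ha, rfl⟩ | ⟨j, h1, rfl⟩)
    · have hP : AnalyticAt ℂ (fun y : CSpace n × (Fin n → ℂ) => a y.1) (0, p) :=
        AnalyticAt.comp (g := a) ha analyticAt_fst
      refine ⟨_, ⟨fun y => a y.1, hP, ⟨{0}, fun _ => a, fun _ _ => ha, ?_⟩, rfl⟩, ?_⟩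
      · intro x y; simp
      · rw [h.pull_toMero]; rfl
    · have hP : AnalyticAt ℂ (fun y : CSpace n × (Fin n → ℂ) => y.2 j) (0, p) :=
        ((ContinuousLinearMap.proj (R := ℂ) (φ := fun _ : Fin n => ℂ) j).comp
          (ContinuousLinearMap.snd ℂ (CSpace n) (Fin n → ℂ))).analyticAt _
      refine ⟨_, ⟨fun y => y.2 j, hP, ⟨{Pi.single j 1}, fun _ _ => 1,
        fun _ _ => analyticAt_const, ?_⟩, rfl⟩, ?_⟩
      · intro x y
        rw [Finset.sum_singleton, one_mul, Finset.prod_eq_single j]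
        · simp
        · intro i _ hi; simp [hi]
        · simp
      · rw [h.pull_toMero]; rfl

/-- The transcendence degree computed on the complexification. -/
theorem transcendenceDegree_eq_relrank (hρ : AnalyticAt ℂ ρ 0) (h0 : ρ 0 = 0) {p : Fin n → ℂ}
    {κ : CSpace n × (Fin n → ℂ) → (Fin n → ℂ) × (Fin n → ℂ) × ℂ}
    (h : IsBiholoGerm 0 ((0 : CSpace n), p) (segreJet ρ) κ)
    {Φ : Fin n → Fin n → CSpace n × (Fin n → ℂ) → ℂ}
    (hΦ : ∀ k l, AnalyticAt ℂ (Φ k l) (0, p))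
    (hs : ∀ᶠ q in 𝓝 (0 : (Fin n → ℂ) × (Fin n → ℂ) × ℂ), ∀ k l,
      dz k (dz l ρ) q = Φ k l (segreJet ρ q)) :
    transcendenceDegree (0 : CSpace n) p
      (fun j : Fin (n * n) => Φ (finProdFinEquiv.symm j).1 (finProdFinEquiv.symm j).2)
      (fun _ => hΦ _ _) =
    Cardinal.toENat (Subfield.relrank (segreField ρ) (segreFieldExt ρ)) := by
  rw [transcendenceDegree_eq, ← Subfield.relrank_map_map _ _ h.pull, map_baseField hρ h0 h,
    RingHom.map_field_closure, Set.image_union]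
  congr 2
  unfold segreFieldExt
  have e1 : h.pull '' (baseField (0 : CSpace n) p) = segreField ρ := by
    rw [← map_baseField hρ h0 h]; rfl
  have hkl : ∀ k l (ha : AnalyticAt ℂ (dz k (dz l ρ)) 0),
      h.pull (toMero (Φ k l) (hΦ k l)) = toMero (dz k (dz l ρ)) ha := by
    intro k l ha
    rw [h.pull_toMero]
    apply toMero_congr
    filter_upwards [hs] with q hq
    exact (hq k l).symm
  rw [e1]
  congr 2
  ext g
  constructor
  · rintro ⟨_, ⟨j, rfl⟩, rfl⟩
    exact ⟨_, _, analyticAt_dz (analyticAt_dz hρ _) _, hkl _ _ _⟩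
  · rintro ⟨k, l, ha, rfl⟩
    refine ⟨_, ⟨finProdFinEquiv (k, l), rfl⟩, ?_⟩
    rw [← hkl k l ha]
    simp

end SegreField

/-! ### Transformation of the Segre family under a biholomorphism. -/

/-- The map `(z, ζ, ω) ↦ (F (z, ρ), Ḡ (ζ, ω))` induced by `G = (F, g)` on the Segre family. -/
def segreTransform (ρ : (Fin n → ℂ) × (Fin n → ℂ) × ℂ → ℂ) (G : CSpace n → CSpace n)
    (q : (Fin n → ℂ) × (Fin n → ℂ) × ℂ) : (Fin n → ℂ) × (Fin n → ℂ) × ℂ :=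
  ((G (segreGraph ρ q)).1, star (G (star q.2)))

section Transform

variable {ρ ρ' : (Fin n → ℂ) × (Fin n → ℂ) × ℂ → ℂ} {G G' : CSpace n → CSpace n}

theorem analyticAt_conj_snd (hG : AnalyticAt ℂ G 0) :
    AnalyticAt ℂ (fun q : (Fin n → ℂ) × CSpace n => star (G (star q.2))) 0 :=
  AnalyticAt.comp (g := fun η : CSpace n => star (G (star η)))
    (analyticAt_star_star (by simpa using hG)) analyticAt_snd

theorem analyticAt_segreTransform (hρ : AnalyticAt ℂ ρ 0) (h0 : ρ 0 = 0)
    (hG : AnalyticAt ℂ G 0) : AnalyticAt ℂ (segreTransform ρ G) 0 :=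
  (analyticAt_fst.comp (analyticAt_comp_segreGraph hρ h0 hG)).prod (analyticAt_conj_snd hG)

theorem segreTransform_zero (h0 : ρ 0 = 0) (hG0 : G 0 = 0) : segreTransform ρ G 0 = 0 := by
  simp [segreTransform, segreGraph, h0, Prod.mk_zero_zero, hG0]

/-- The graph identity recovers `z` from `G' ∘ G = id`; the conjugate of the same relation recovers
`(ζ, ω)`. -/
theorem segreTransform_left_inv (hρ : AnalyticAt ℂ ρ 0) (h0 : ρ 0 = 0)
    (hG : IsBiholoGerm 0 0 G G')
    (hgraph : ∀ᶠ q in 𝓝 (0 : (Fin n → ℂ) × (Fin n → ℂ) × ℂ),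
      segreGraph ρ' (segreTransform ρ G q) = G (segreGraph ρ q)) :
    ∀ᶠ q in 𝓝 (0 : (Fin n → ℂ) × (Fin n → ℂ) × ℂ),
      segreTransform ρ' G' (segreTransform ρ G q) = q := by
  have ht : Filter.Tendsto (fun q : (Fin n → ℂ) × (Fin n → ℂ) × ℂ => star q.2)
      (𝓝 0) (𝓝 0) := by
    have : ContinuousAt (fun q : (Fin n → ℂ) × (Fin n → ℂ) × ℂ => star q.2) 0 := by fun_prop
    simpa [ContinuousAt] using this.tendsto
  filter_upwards [hgraph, (tendsto_segreGraph hρ h0).eventually hG.left_inv,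
    ht.eventually hG.left_inv] with q h1 h2 h3
  refine Prod.ext ?_ ?_
  · change (G' (segreGraph ρ' (segreTransform ρ G q))).1 = q.1
    rw [h1, h2]; rfl
  · change star (G' (star (star (G (star q.2))))) = q.2
    rw [star_star, h3, star_star]

/-- A local biholomorphism maps Segre varieties to Segre varieties. -/
theorem segreGraph_segreTransform {N N' : Set (CSpace n)} {R : CSpace n × CSpace n → ℂ}
    (hR : IsNondegComplexification N R)
    (hρ : IsComplexDefiningFunction N ρ) (hρ' : IsComplexDefiningFunction N' ρ')
    (hG : AnalyticAt ℂ G 0) (hG0 : G 0 = 0)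
    (hmem : ∀ᶠ x in 𝓝 (0 : CSpace n), x ∈ N → G x ∈ N') :
    ∀ᶠ q in 𝓝 (0 : (Fin n → ℂ) × (Fin n → ℂ) × ℂ),
      segreGraph ρ' (segreTransform ρ G q) = G (segreGraph ρ q) := by
  have h0 := hρ.map_zero hR
  have ha : AnalyticAt ℂ (fun q => ρ' (segreTransform ρ G q) - (G (segreGraph ρ q)).2) 0 := by
    refine AnalyticAt.sub (AnalyticAt.comp (g := ρ') ?_ (analyticAt_segreTransform hρ.1 h0 hG))
      (analyticAt_snd.comp (analyticAt_comp_segreGraph hρ.1 h0 hG))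
    rw [segreTransform_zero h0 hG0]; exact hρ'.1
  have hGt : Filter.Tendsto G (𝓝 0) (𝓝 0) := by
    simpa [ContinuousAt, hG0] using hG.continuousAt.tendsto
  -- At `q = (z, x̄)` with `x ∈ N` the claim is exactly that `G x` satisfies the equation of `N'`;
  -- the identity principle extends it to all `q`.
  have := hR.identity hρ ha (by
    filter_upwards [hmem, hρ.2, hGt.eventually hρ'.2] with x h1 h2 h3 hx
    have e1 : segreGraph ρ (x.1, star x) = x := Prod.ext rfl (h2.1 hx).symm
    have e2 : segreTransform ρ G (x.1, star x) = ((G x).1, star (G x)) := by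
      simp only [segreTransform, e1, star_star]
    rw [e1, e2]
    exact sub_eq_zero.2 (h3.1 (h1 hx)).symm)
  filter_upwards [this] with q hq
  exact Prod.ext rfl (sub_eq_zero.1 hq)

/-- Chain rule for the transformation of the Segre family. -/
theorem dz_comp_segreTransform (hρ : AnalyticAt ℂ ρ 0) (h0 : ρ 0 = 0) (hG : AnalyticAt ℂ G 0)
    (hG0 : G 0 = 0) {v : (Fin n → ℂ) × (Fin n → ℂ) × ℂ → ℂ} (hv : AnalyticAt ℂ v 0) (l : Fin n) :
    ∀ᶠ q in 𝓝 (0 : (Fin n → ℂ) × (Fin n → ℂ) × ℂ),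
      ∑ k, dz l (fun q => (G (segreGraph ρ q)).1 k) q * dz k v (segreTransform ρ G q) =
        dz l (fun q => v (segreTransform ρ G q)) q := by
  have hσ := analyticAt_segreTransform hρ h0 hG
  have hσt : Filter.Tendsto (segreTransform ρ G) (𝓝 0) (𝓝 0) := by
    simpa [ContinuousAt, segreTransform_zero h0 hG0] using hσ.continuousAt.tendsto
  have hst : AnalyticAt ℂ (fun η : CSpace n => star (G (star η))) 0 :=
    analyticAt_star_star (by simpa using hG)
  have hsnd : Filter.Tendsto (Prod.snd : (Fin n → ℂ) × CSpace n → CSpace n) (𝓝 0) (𝓝 0) :=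
    continuous_snd.tendsto 0
  filter_upwards [(analyticAt_comp_segreGraph hρ h0 hG).eventually_analyticAt,
    hsnd.eventually hst.eventually_analyticAt,
    hσt.eventually hv.eventually_analyticAt] with q h1 h2 h3
  have hC : ∀ k, DifferentiableAt ℂ (fun q => (G (segreGraph ρ q)).1 k) q := fun k =>
    differentiableAt_pi.1 h1.differentiableAt.fst k
  have hd : HasFDerivAt (segreTransform ρ G)
      ((ContinuousLinearMap.pi fun k => fderiv ℂ (fun q => (G (segreGraph ρ q)).1 k) q).prod
        ((fderiv ℂ (fun η : CSpace n => star (G (star η))) q.2).comp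
          (ContinuousLinearMap.snd ℂ _ _))) q :=
    (hasFDerivAt_pi.2 fun k => (hC k).hasFDerivAt).prodMk
      (h2.differentiableAt.hasFDerivAt.comp q hasFDerivAt_snd)
  have hc : HasFDerivAt (fun q => v (segreTransform ρ G q)) _ q :=
    h3.differentiableAt.hasFDerivAt.comp q hd
  conv_rhs => rw [dz, hc.fderiv, ContinuousLinearMap.comp_apply]
  -- The last two components of the transformation do not involve `z`, so a `z`-derivative only
  -- moves the first.
  have hdec : ((ContinuousLinearMap.pi fun k =>
        fderiv ℂ (fun q => (G (segreGraph ρ q)).1 k) q).prod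
        ((fderiv ℂ (fun η : CSpace n => star (G (star η))) q.2).comp
          (ContinuousLinearMap.snd ℂ _ _))) ((Pi.single l 1, 0, 0) : (Fin n → ℂ) × CSpace n) =
      ∑ k, dz l (fun q => (G (segreGraph ρ q)).1 k) q •
        ((Pi.single k 1, 0, 0) : (Fin n → ℂ) × (Fin n → ℂ) × ℂ) := by
    refine Prod.ext ?_ ?_
    · rw [Prod.fst_sum]
      ext i
      simp [Finset.sum_apply, Pi.single_apply, dz]
    · rw [Prod.snd_sum]
      have : (((0 : Fin n → ℂ), (0 : ℂ)) : CSpace n) = 0 := rfl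
      simp [this]
  rw [hdec, map_sum]
  refine Finset.sum_congr rfl fun k _ => ?_
  rw [map_smul, smul_eq_mul]; rfl

/-- A left null vector `c` of the matrix would put `(c, 0)` in the kernel of the differential of the
transformation, which is invertible. -/
theorem det_segreTransform_ne (hρ : AnalyticAt ℂ ρ 0) (h0 : ρ 0 = 0) (hG : AnalyticAt ℂ G 0)
    {σ' : (Fin n → ℂ) × (Fin n → ℂ) × ℂ → (Fin n → ℂ) × (Fin n → ℂ) × ℂ}
    (hσ : IsBiholoGerm 0 0 (segreTransform ρ G) σ') :
    Matrix.det (Matrix.of fun l k => dz l (fun q => (G (segreGraph ρ q)).1 k) 0) ≠ 0 := by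
  intro hdet
  obtain ⟨c, hc, hcA⟩ := Matrix.exists_vecMul_eq_zero_iff.2 hdet
  apply hc
  have h1 : HasFDerivAt (segreTransform ρ G) (fderiv ℂ (segreTransform ρ G) 0) 0 :=
    hσ.analytic.differentiableAt.hasFDerivAt
  have h2 : HasFDerivAt σ' (fderiv ℂ σ' 0) (segreTransform ρ G 0) := by
    rw [hσ.map_base]; exact hσ.analytic_symm.differentiableAt.hasFDerivAt
  have h3 := (h2.comp (0 : (Fin n → ℂ) × (Fin n → ℂ) × ℂ) h1).unique
    ((hasFDerivAt_id (𝕜 := ℂ) _).congr_of_eventuallyEq hσ.left_inv)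
  have h4 := congrArg (fun A => A ((c, 0) : (Fin n → ℂ) × CSpace n)) h3
  have hst : AnalyticAt ℂ (fun η : CSpace n => star (G (star η))) 0 :=
    analyticAt_star_star (by simpa using hG)
  have hC : ∀ k, DifferentiableAt ℂ (fun q => (G (segreGraph ρ q)).1 k) 0 := fun k =>
    differentiableAt_pi.1 (analyticAt_comp_segreGraph hρ h0 hG).differentiableAt.fst k
  have hd : HasFDerivAt (segreTransform ρ G)
      ((ContinuousLinearMap.pi fun k => fderiv ℂ (fun q => (G (segreGraph ρ q)).1 k) 0).prod
        ((fderiv ℂ (fun η : CSpace n => star (G (star η))) 0).comp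
          (ContinuousLinearMap.snd ℂ _ _))) 0 :=
    (hasFDerivAt_pi.2 fun k => (hC k).hasFDerivAt).prodMk
      (HasFDerivAt.comp (0 : (Fin n → ℂ) × CSpace n) (g := fun η : CSpace n => star (G (star η)))
        hst.differentiableAt.hasFDerivAt hasFDerivAt_snd)
  have h5 : fderiv ℂ (segreTransform ρ G) 0 ((c, 0) : (Fin n → ℂ) × CSpace n) = 0 := by
    rw [hd.fderiv]
    refine Prod.ext ?_ ?_
    · ext k
      have h6 := congrFun hcA k
      have hdec : ((c, 0) : (Fin n → ℂ) × CSpace n) =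
          ∑ l, c l • ((Pi.single l 1, 0, 0) : (Fin n → ℂ) × (Fin n → ℂ) × ℂ) := by
        refine Prod.ext ?_ ?_
        · rw [Prod.fst_sum]; ext i; simp [Finset.sum_apply, Pi.single_apply]
        · rw [Prod.snd_sum]
          have : (((0 : Fin n → ℂ), (0 : ℂ)) : CSpace n) = 0 := rfl
          simp [this]
      change fderiv ℂ (fun q => (G (segreGraph ρ q)).1 k) 0 ((c, 0) : (Fin n → ℂ) × CSpace n) = 0
      rw [hdec, map_sum]
      refine Eq.trans ?_ h6
      refine Finset.sum_congr rfl fun l _ => ?_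
      rw [map_smul, smul_eq_mul]; rfl
    · simp
  rw [ContinuousLinearMap.comp_apply, h5, map_zero] at h4
  exact (congrArg Prod.fst h4).symm

/-- Derivatives transform linearly, with coefficients in the Segre field. -/
theorem germIn_dz_comp_segreTransform (hρ : AnalyticAt ℂ ρ 0) (h0 : ρ 0 = 0)
    (hG : AnalyticAt ℂ G 0) (hG0 : G 0 = 0)
    {σ' : (Fin n → ℂ) × (Fin n → ℂ) × ℂ → (Fin n → ℂ) × (Fin n → ℂ) × ℂ}
    (hσ : IsBiholoGerm 0 0 (segreTransform ρ G) σ')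
    {T : Subfield (MeroGerms (0 : (Fin n → ℂ) × (Fin n → ℂ) × ℂ))} (hT : segreField ρ ≤ T)
    {v : (Fin n → ℂ) × (Fin n → ℂ) × ℂ → ℂ} (hv : AnalyticAt ℂ v 0)
    (h : ∀ l, GermIn T (dz l fun q => v (segreTransform ρ G q))) (k : Fin n) :
    GermIn T (fun q => dz k v (segreTransform ρ G q)) := by
  have hCa : ∀ k, AnalyticAt ℂ (fun x => (G x).1 k) 0 := fun k =>
    analyticAt_pi_iff.1 (analyticAt_fst.comp hG) k
  exact germIn_of_linear_system (A := fun l k => dz l fun q => (G (segreGraph ρ q)).1 k)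
    (fun l k => (germIn_dz_comp_segreGraph hρ h0 (hCa k) l).mono hT)
    (det_segreTransform_ne hρ h0 hG hσ) h
    (fun k => hσ.comp_analyticAt (analyticAt_dz hv k))
    (fun l => dz_comp_segreTransform hρ h0 hG hG0 hv l) k

section Pull

variable (hρ : AnalyticAt ℂ ρ 0) (h0 : ρ 0 = 0) (hρ' : AnalyticAt ℂ ρ' 0)
  (hG : AnalyticAt ℂ G 0) (hG0 : G 0 = 0)
  (hσ : IsBiholoGerm 0 0 (segreTransform ρ G) (segreTransform ρ' G'))
  (hgraph : ∀ᶠ q in 𝓝 (0 : (Fin n → ℂ) × (Fin n → ℂ) × ℂ),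
    segreGraph ρ' (segreTransform ρ G q) = G (segreGraph ρ q))

include hρ h0 hρ' hG hG0 hσ hgraph

/-- The composite of `ρ'` with the transformation is the last component of `G (z, ρ)`, whose first
`z`-derivatives lie in `segreField ρ`. -/
theorem germIn_dz_segreTransform (k : Fin n) :
    GermIn (segreField ρ) (fun q => dz k ρ' (segreTransform ρ G q)) := by
  refine germIn_dz_comp_segreTransform hρ h0 hG hG0 hσ le_rfl hρ' (fun l => ?_) k
  refine (germIn_dz_comp_segreGraph hρ h0 (a := fun x => (G x).2)
    (analyticAt_snd.comp hG) l).congr (dz_congr ?_ l)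
  filter_upwards [hgraph] with q hq
  exact (congrArg Prod.snd hq).symm

/-- Two linear solves with the same matrix: one finds the `z`-derivatives of the pulled-back `ρ'_z`
from the twice differentiated graph identity, the other converts them into the pulled-back `ρ'_zz`.
-/
theorem germIn_dz_dz_segreTransform (j k : Fin n) :
    GermIn (segreFieldExt ρ) (fun q => dz j (dz k ρ') (segreTransform ρ G q)) := by
  have hle := segreField_le_segreFieldExt (ρ := ρ)
  have hCa : ∀ k, AnalyticAt ℂ (fun x => (G x).1 k) 0 := fun k =>
    analyticAt_pi_iff.1 (analyticAt_fst.comp hG) k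
  have hga : AnalyticAt ℂ (fun x => (G x).2) 0 := analyticAt_snd.comp hG
  have hu : ∀ k, AnalyticAt ℂ (fun q => dz k ρ' (segreTransform ρ G q)) 0 := fun k =>
    hσ.comp_analyticAt (analyticAt_dz hρ' k)
  refine germIn_dz_comp_segreTransform hρ h0 hG hG0 hσ hle (analyticAt_dz hρ' k) (fun m => ?_) j
  refine germIn_of_linear_system (A := fun l k => dz l fun q => (G (segreGraph ρ q)).1 k)
    (v := fun k => dz m fun q => dz k ρ' (segreTransform ρ G q))
    -- The right-hand side is what the product rule leaves once the terms containing the unknowns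
    -- are isolated.
    (b := fun l q => dz m (dz l fun q => (G (segreGraph ρ q)).2) q -
      ∑ k, dz m (dz l fun q => (G (segreGraph ρ q)).1 k) q * dz k ρ' (segreTransform ρ G q))
    (fun l k => (germIn_dz_comp_segreGraph hρ h0 (hCa k) l).mono hle)
    (det_segreTransform_ne hρ h0 hG hσ) (fun l => ?_)
    (fun k => analyticAt_dz (hu k) m) (fun l => ?_) k
  · exact (germIn_dz_dz_comp_segreGraph hρ h0 hga m l).sub
      (GermIn.sum _ fun k _ => (germIn_dz_dz_comp_segreGraph hρ h0 (hCa k) m l).mul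
        ((germIn_dz_segreTransform hρ h0 hρ' hG hG0 hσ hgraph k).mono hle))
  · have hCl : ∀ k, AnalyticAt ℂ (dz l fun q => (G (segreGraph ρ q)).1 k) 0 := fun k =>
      analyticAt_dz (analyticAt_comp_segreGraph hρ h0 (hCa k)) l
    have e1 : (fun q => ∑ k, dz l (fun q => (G (segreGraph ρ q)).1 k) q *
          dz k ρ' (segreTransform ρ G q)) =ᶠ[𝓝 0] dz l fun q => (G (segreGraph ρ q)).2 := by
      refine Filter.EventuallyEq.trans (dz_comp_segreTransform hρ h0 hG hG0 hρ' l)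
        (dz_congr ?_ l)
      filter_upwards [hgraph] with q hq
      exact congrArg Prod.snd hq
    filter_upwards [dz_congr e1 m, Filter.eventually_all.2 fun k => (hCl k).eventually_analyticAt,
      Filter.eventually_all.2 fun k => (hu k).eventually_analyticAt] with q h1 h2 h3
    rw [← h1, dz_sum _ (fun k => (h2 k).fun_mul (h3 k)), ← Finset.sum_sub_distrib]
    refine Finset.sum_congr rfl fun k _ => ?_
    rw [dz_mul (h2 k) (h3 k)]
    ring

theorem map_segreField_le : (segreField ρ').map hσ.pull ≤ segreField ρ := by
  rw [segreField, RingHom.map_field_closure, Subfield.closure_le]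
  rintro _ ⟨_, (⟨a, h1, ha, rfl⟩ | ⟨j, h1, rfl⟩), rfl⟩
  · rw [hσ.pull_toMero]
    have h2 : AnalyticAt ℂ (fun x => a (G x)) 0 :=
      AnalyticAt.comp (g := a) (by rwa [hG0]) hG
    refine ((germIn_comp_segreGraph hρ h0 h2).congr ?_).2
    filter_upwards [hgraph] with q hq
    simp [hq]
  · rw [hσ.pull_toMero]
    exact (germIn_dz_segreTransform hρ h0 hρ' hG hG0 hσ hgraph j).2

theorem map_segreFieldExt_le : (segreFieldExt ρ').map hσ.pull ≤ segreFieldExt ρ := by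
  conv_lhs => rw [segreFieldExt]
  rw [RingHom.map_field_closure, Subfield.closure_le]
  rintro _ ⟨x, (hx | ⟨k, l, h1, rfl⟩), rfl⟩
  · exact segreField_le_segreFieldExt (map_segreField_le hρ h0 hρ' hG hG0 hσ hgraph ⟨x, hx, rfl⟩)
  · rw [hσ.pull_toMero]
    exact (germIn_dz_dz_segreTransform hρ h0 hρ' hG hG0 hσ hgraph k l).2

end Pull

end Transform

/-! ### Invariance and existence of the degree. -/

/-- The degree of the extension generated by the second derivatives is a biholomorphic
invariant. -/
theorem relrank_segreField_eq {N N' : Set (CSpace n)} {R R' : CSpace n × CSpace n → ℂ}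
    {ρ ρ' : (Fin n → ℂ) × (Fin n → ℂ) × ℂ → ℂ} {G G' : CSpace n → CSpace n}
    (hR : IsNondegComplexification N R) (hR' : IsNondegComplexification N' R')
    (hρ : IsComplexDefiningFunction N ρ) (hρ' : IsComplexDefiningFunction N' ρ')
    (hG : IsBiholoGerm 0 0 G G') (hmem : ∀ᶠ x in 𝓝 (0 : CSpace n), x ∈ N ↔ G x ∈ N') :
    Subfield.relrank (segreField ρ) (segreFieldExt ρ) =
      Subfield.relrank (segreField ρ') (segreFieldExt ρ') := by
  have h0 := hρ.map_zero hR
  have h0' := hρ'.map_zero hR'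
  have hmem' : ∀ᶠ x in 𝓝 (0 : CSpace n), x ∈ N' → G' x ∈ N := by
    filter_upwards [hG.symm.tendsto.eventually hmem, hG.right_inv] with x h1 h2 h3
    rw [h1, h2]; exact h3
  have hg := segreGraph_segreTransform hR hρ hρ' hG.analytic hG.map_base
    (hmem.mono fun _ h => h.1)
  have hg' := segreGraph_segreTransform hR' hρ' hρ hG.analytic_symm hG.map_base_symm hmem'
  have hσ : IsBiholoGerm 0 0 (segreTransform ρ G) (segreTransform ρ' G') :=
    ⟨analyticAt_segreTransform hρ.1 h0 hG.analytic, segreTransform_zero h0 hG.map_base,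
      analyticAt_segreTransform hρ'.1 h0' hG.analytic_symm,
      segreTransform_left_inv hρ.1 h0 hG hg, segreTransform_left_inv hρ'.1 h0' hG.symm hg'⟩
  have e1 : (segreField ρ').map hσ.pull = segreField ρ := by
    refine le_antisymm (map_segreField_le hρ.1 h0 hρ'.1 hG.analytic hG.map_base hσ hg) ?_
    -- The reverse inclusion is the same statement for the inverse map, carried back by `pull_pull`.
    intro x hx
    exact ⟨hσ.symm.pull x, map_segreField_le hρ'.1 h0' hρ.1 hG.analytic_symm hG.map_base_symm
      hσ.symm hg' ⟨x, hx, rfl⟩, hσ.pull_pull x⟩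
  have e2 : (segreFieldExt ρ').map hσ.pull = segreFieldExt ρ := by
    refine le_antisymm (map_segreFieldExt_le hρ.1 h0 hρ'.1 hG.analytic hG.map_base hσ hg) ?_
    intro x hx
    exact ⟨hσ.symm.pull x, map_segreFieldExt_le hρ'.1 h0' hρ.1 hG.analytic_symm
      hG.map_base_symm hσ.symm hg' ⟨x, hx, rfl⟩, hσ.pull_pull x⟩
  rw [← e1, ← e2, Subfield.relrank_map_map]

theorem isBiholoGerm_continuousLinearEquiv {V W : Type*} [NormedAddCommGroup V]
    [NormedSpace ℂ V] [NormedAddCommGroup W] [NormedSpace ℂ W] (L : V ≃L[ℂ] W) :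
    IsBiholoGerm 0 0 L L.symm :=
  ⟨L.toContinuousLinearMap.analyticAt 0, map_zero L, L.symm.toContinuousLinearMap.analyticAt 0,
    Filter.Eventually.of_forall L.symm_apply_apply, Filter.Eventually.of_forall L.apply_symm_apply⟩

/-- The jet transcendence degree is a biholomorphic invariant. -/
theorem IsJetTranscendenceDegree.eq {M M' : Set (CSpace n)}
    (hM : IsLeviNondegenerateHypersurface M) (hM' : IsLeviNondegenerateHypersurface M')
    {H : OpenPartialHomeomorph (CSpace n) (CSpace n)} (hH : IsLocalBiholomorphism M M' H)
    {d d' : ℕ∞} (hd : IsJetTranscendenceDegree M d) (hd' : IsJetTranscendenceDegree M' d') :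
    d = d' := by
  obtain ⟨L, p, Φ, hΦ, ⟨ρ, hρ, hp, -, hs⟩, rfl⟩ := hd
  obtain ⟨L', p', Φ', hΦ', ⟨ρ', hρ', hp', -, hs'⟩, rfl⟩ := hd'
  obtain ⟨R, hR⟩ := (hM.image L).exists_complexification
  obtain ⟨R', hR'⟩ := (hM'.image L').exists_complexification
  obtain rfl : p = fun j => dz j ρ 0 := funext hp
  obtain rfl : p' = fun j => dz j ρ' 0 := funext hp'
  obtain ⟨κ, hκ⟩ := hR.exists_isBiholoGerm_segreJet hρ
  obtain ⟨κ', hκ'⟩ := hR'.exists_isBiholoGerm_segreJet hρ'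
  rw [transcendenceDegree_eq_relrank hρ.1 (hρ.map_zero hR) hκ hΦ hs,
    transcendenceDegree_eq_relrank hρ'.1 (hρ'.map_zero hR') hκ' hΦ' hs']
  obtain ⟨hs0, hH0, hHa, hHa', himg⟩ := hH
  have ht0 : (0 : CSpace n) ∈ H.target := hH0 ▸ H.map_source hs0
  have hHg : IsBiholoGerm 0 0 H H.symm :=
    ⟨hHa 0 hs0, hH0, hHa' 0 ht0, by
      filter_upwards [H.open_source.mem_nhds hs0] with x hx using H.left_inv hx, by
      filter_upwards [H.open_target.mem_nhds ht0] with x hx using H.right_inv hx⟩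
  -- The map between the two coordinate systems is `L' ∘ H ∘ L⁻¹`, so changes of coordinates need no
  -- separate argument.
  have hG := ((isBiholoGerm_continuousLinearEquiv L.symm).trans hHg).trans
    (isBiholoGerm_continuousLinearEquiv L')
  rw [relrank_segreField_eq hR hR' hρ hρ' hG ?_]
  filter_upwards [(isBiholoGerm_continuousLinearEquiv L.symm).tendsto.eventually
    (H.open_source.mem_nhds hs0)] with x hx
  have hx' : L.symm x ∈ H.source := hx
  have key : L.symm x ∈ M ↔ H (L.symm x) ∈ M' := by
    constructor
    · intro h
      have : H (L.symm x) ∈ H '' (M ∩ H.source) := ⟨_, ⟨h, hx'⟩, rfl⟩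
      rw [himg] at this
      exact this.1
    · intro h
      have : H (L.symm x) ∈ M' ∩ H.target := ⟨h, H.map_source hx'⟩
      rw [← himg] at this
      obtain ⟨y, ⟨hyM, hys⟩, hy⟩ := this
      rwa [← H.injOn hys hx' hy]
  have e1 : x ∈ L '' M ↔ L.symm x ∈ M := by
    constructor
    · rintro ⟨y, hy, rfl⟩; simpa using hy
    · intro h; exact ⟨_, h, by simp⟩
  have e2 : L' (H (L.symm x)) ∈ L' '' M' ↔ H (L.symm x) ∈ M' := by
    constructor
    · rintro ⟨y, hy, h⟩; rwa [← L'.injective h]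
    · intro h; exact ⟨_, h, rfl⟩
  rw [e1, key, ← e2]
  rfl

/-- The jet transcendence degree exists. -/
theorem IsLeviNondegenerateHypersurface.exists_isJetTranscendenceDegree {M : Set (CSpace n)}
    (hM : IsLeviNondegenerateHypersurface M) : ∃ d, IsJetTranscendenceDegree M d := by
  obtain ⟨L, ρ, hρ⟩ := hM.exists_isComplexDefiningFunction
  obtain ⟨R, hR⟩ := (hM.image L).exists_complexification
  obtain ⟨κ, hκ⟩ := hR.exists_isBiholoGerm_segreJet hρ
  -- The right-hand side is `ρ_zz` expressed through the jet coordinates by the inverse `κ` of the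
  -- jet map.
  have hΦ : ∀ k l, AnalyticAt ℂ (fun y => dz k (dz l ρ) (κ y))
      ((0 : CSpace n), fun j => dz j ρ 0) := fun k l =>
    hκ.symm.comp_analyticAt (analyticAt_dz (analyticAt_dz hρ.1 l) k)
  refine ⟨_, L, fun j => dz j ρ 0, fun k l y => dz k (dz l ρ) (κ y), hΦ,
    ⟨ρ, hρ, fun _ => rfl, hΦ, ?_⟩, rfl⟩
  filter_upwards [hκ.left_inv] with q hq k l
  change _ = dz k (dz l ρ) (κ (segreJet ρ q))
  rw [hq]

/-- Reduces uniqueness of the degree of a single hypersurface to the invariance theorem. -/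
theorem isLocalBiholomorphism_refl (M : Set (CSpace n)) :
    IsLocalBiholomorphism M M (OpenPartialHomeomorph.refl (CSpace n)) := by
  refine ⟨by simp, by simp, fun x _ => ?_, fun x _ => ?_, by simp⟩
  · exact analyticAt_id
  · exact analyticAt_id

end JetTr

end

theorem mainTheorem2 (n : ℕ) (hn : 1 ≤ n) (M M' : Set (JetTr.CSpace n))
    (hM : JetTr.IsLeviNondegenerateHypersurface M)
    (hM' : JetTr.IsLeviNondegenerateHypersurface M')
    (H : OpenPartialHomeomorph (JetTr.CSpace n) (JetTr.CSpace n))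
    (hH : JetTr.IsLocalBiholomorphism M M' H) :
    (∃! d : ℕ∞, JetTr.IsJetTranscendenceDegree M d) ∧
    (∀ d : ℕ∞, JetTr.IsJetTranscendenceDegree M d ↔ JetTr.IsJetTranscendenceDegree M' d) := by
  obtain ⟨d₀, hd₀⟩ := hM.exists_isJetTranscendenceDegree
  obtain ⟨d₁, hd₁⟩ := hM'.exists_isJetTranscendenceDegree
  have h01 : d₀ = d₁ := hd₀.eq hM hM' hH hd₁
  refine ⟨⟨d₀, hd₀, fun d hd => hd.eq hM hM (JetTr.isLocalBiholomorphism_refl M) hd₀⟩,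
    fun d => ⟨fun hd => ?_, fun hd => ?_⟩⟩
  · rw [hd.eq hM hM' hH hd₁]; exact hd₁
  · rw [← hd₀.eq hM hM' hH hd]; exact hd₀
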